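/- Fix $p\in[\frac12,1]$ and consider the following zero-sum repeated game. The system is in one of two states $\underline s,\bar s$; between stages it stays in its current state with probability $p$ and switches with probability $1-p$. At each stage Player 1 plays $T$ or $B$ and Player 2 simultaneously plays $L$ or $R$; Player 1 receives $1$ from Player 2 if the state is $\underline s$ and the moves are $(T,L)$, or if the state is $\bar s$ and the moves are $(B,R)$, and $0$ otherwise. Player 1 knows all past states and moves and the current state before he moves; Player 2 knows only the past moves of both players. Strategies are behaviour strategies: the probability of playing $T$ (resp. $L$) is an arbitrary function of the information available. A number $v$ is the value of the game if Player 1 has a strategy such that, for every initial law of the state and every strategy of Player 2, the $\liminf$ of the expected average gain of Player 1 over the first $n$ stages is at least $v$, and Player 2 has a strategy such that, for every initial law and every strategy of Player 1, the $\limsup$ is at most $v$. A strategy of Player 1 is optimal if the game has a value $v$ and the strategy guarantees $v$ in this sense. Put $\gamma=2p-1$ and, for $\theta\in[0,1]$, $$f_B(\theta)=\begin{cases}p\frac{2\theta-1}{\theta}+(1-p)\frac{1-\theta}{\theta}&\theta\ge\frac12\\1-p&\theta\le\frac12\end{cases},\qquad f_T(\theta)=\begin{cases}p&\theta\ge\frac12\\p\frac{\theta}{1-\theta}+(1-p)\frac{1-2\theta}{1-\theta}&\theta\le\frac12\end{cases},$$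 and $\Phi(\theta)=f_B(\theta)$ if $\theta\ge\frac12$, $\Phi(\theta)=f_T(\theta)$ if $\theta<\frac12$; $\Phi$ maps $[1-p,p]$ into itself. The strategy $\sigma^*$ of Player 1 keeps an internal variable $\theta\in[0,1]$, with an arbitrary initial value $\theta_0$. If $\theta\le\frac12$ it plays $T$ with probability $1$ in state $\underline s$ and $\frac{1-2\theta}{1-\theta}$ in state $\bar s$; if $\theta\ge\frac12$ it plays $T$ with probability $\frac{1-\theta}{\theta}$ in state $\underline s$ and $0$ in state $\bar s$. After playing $T$ (resp. $B$), $\theta$ is replaced by $f_T(\theta)$ (resp. $f_B(\theta)$). Suppose that $p$ satisfies $$\sum_{n\ge0}\ \sum_{\theta\in[1-p,p],\ \Phi^n(\theta)=\frac12}\ \prod_{i=0}^{n-1}\frac{\gamma}{\max(\Phi^i(\theta),1-\Phi^i(\theta))}<\infty .$$ Then, for every initial value $\theta_0\in[0,1]$, $\sigma^*$ is an optimal strategy for Player 1. -/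

import Mathlib

namespace AsymmetricGame

open Filter unitInterval

/-- The two states of the system: `lo` is the state with payoff matrix `(1 0; 0 0)`,
`hi` is the state with payoff matrix `(0 0; 0 1)`. -/
inductive State
  | lo
  | hi

/-- Moves of Player 1: top and bottom. -/
inductive Move₁
  | T
  | B

/-- Moves of Player 2: left and right. -/
inductive Move₂
  | L
  | R

/-- What happens in one stage: the state of the system and the moves of the two players. -/
abbrev Stage := State × Move₁ × Move₂

/-- The amount that Player 1 receives in a stage. -/
def payoff : Stage → ℝ
  | (State.lo, Move₁.T, Move₂.L) => 1
  | (State.hi, Move₁.B, Move₂.R) => 1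
  | _ => 0

/-- A (behaviour) strategy of Player 1: the probability of playing `T`, as a function of the
past stages (most recent first; Player 1 knows the past states and all past moves) and of the
current state. -/
abbrev Strategy₁ := List Stage → State → I

/-- A (behaviour) strategy of Player 2: the probability of playing `L`, as a function of the past
moves of both players (most recent first); Player 2 never sees the states. -/
abbrev Strategy₂ := List (Move₁ × Move₂) → I

/-- The law that gives mass `t` to `x` and mass `1 - t` to `y`. -/
noncomputable def choice {α : Type} (t : I) (x y : α) : PMF α :=
  (PMF.ofFintype (fun b : Bool => ENNReal.ofReal (if b then (t : ℝ) else 1 - t)) (by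
    have h0 := t.2.1
    have h1 := t.2.2
    simp only [Fintype.sum_bool, if_true, Bool.false_eq_true, if_false]
    rw [← ENNReal.ofReal_add h0 (by linarith)]
    simp)).map (fun b => if b then x else y)

/-- The law of the next state: the system stays in its state with probability `p` and switches
with probability `1 - p`. -/
noncomputable def nextState (p : I) : State → PMF State
  | State.lo => choice p State.lo State.hi
  | State.hi => choice p State.hi State.lo

/-- The joint law of the first `n` stages (most recent first) and of the state in which the
following stage is played, if the initial state is `lo` with probability `q` and the players use
the strategies `s₁` and `s₂`. Given the past and the current state, the two players randomize
independently. -/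
noncomputable def playLaw (p q : I) (s₁ : Strategy₁) (s₂ : Strategy₂) :
    ℕ → PMF (List Stage × State)
  | 0 => (choice q State.lo State.hi).map fun s => ([], s)
  | n + 1 =>
    (playLaw p q s₁ s₂ n).bind fun z =>
      (choice (s₁ z.1 z.2) Move₁.T Move₁.B).bind fun a =>
        (choice (s₂ (z.1.map Prod.snd)) Move₂.L Move₂.R).bind fun b =>
          (nextState p z.2).map fun s' => ((z.2, a, b) :: z.1, s')

/-- The expected average gain of Player 1 per stage over the first `n` stages. -/
noncomputable def averageGain (p q : I) (s₁ : Strategy₁) (s₂ : Strategy₂) (n : ℕ) : ℝ :=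
  (∑' z : List Stage × State,
    (playLaw p q s₁ s₂ n z).toReal * (z.1.map payoff).sum) / n

/-- Using `s₁`, Player 1 has long-term expected gain at least `v`, whatever the initial law and
whatever Player 2 does: the lower limit of the expected average gains is at least `v`. -/
def Guarantees₁ (p : I) (s₁ : Strategy₁) (v : ℝ) : Prop :=
  ∀ (q : I) (s₂ : Strategy₂), ∀ w < v, ∀ᶠ n in atTop, w < averageGain p q s₁ s₂ n

/-- If Player 2 uses `s₂`, then Player 1 has long-term expected gain at most `v`, whatever the
initial law and whatever Player 1 does: the upper limit of the expected average gains is at most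
`v`. -/
def Guarantees₂ (p : I) (s₂ : Strategy₂) (v : ℝ) : Prop :=
  ∀ (q : I) (s₁ : Strategy₁), ∀ w > v, ∀ᶠ n in atTop, averageGain p q s₁ s₂ n < w

/-- `v` is the value of the game: Player 1 can guarantee at least `v` and Player 2 can guarantee
at most `v`. -/
def IsValue (p : I) (v : ℝ) : Prop :=
  (∃ s₁, Guarantees₁ p s₁ v) ∧ (∃ s₂, Guarantees₂ p s₂ v)

/-- `s₁` is an optimal strategy of Player 1: it guarantees the value of the game. -/
def IsOptimal₁ (p : I) (s₁ : Strategy₁) : Prop :=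
  ∃ v, IsValue p v ∧ Guarantees₁ p s₁ v

/-- The map `f_B`. -/
noncomputable def fB (p θ : ℝ) : ℝ :=
  if 1 / 2 ≤ θ then p * ((2 * θ - 1) / θ) + (1 - p) * ((1 - θ) / θ) else 1 - p

/-- The map `f_T`. -/
noncomputable def fT (p θ : ℝ) : ℝ :=
  if 1 / 2 ≤ θ then p else p * (θ / (1 - θ)) + (1 - p) * ((1 - 2 * θ) / (1 - θ))

/-- The map `Φ`. -/
noncomputable def Phi (p θ : ℝ) : ℝ :=
  if 1 / 2 ≤ θ then fB p θ else fT p θ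

/-- The probability with which `σ*` plays `T` if the internal state is `θ`. -/
noncomputable def probT (θ : ℝ) : State → ℝ
  | State.lo => if θ ≤ 1 / 2 then 1 else (1 - θ) / θ
  | State.hi => if θ ≤ 1 / 2 then (1 - 2 * θ) / (1 - θ) else 0

theorem fB_mem (p θ : I) : fB p θ ∈ I := by
  obtain ⟨p, hp0, hp1⟩ := p
  obtain ⟨θ, h0, h1⟩ := θ
  unfold fB
  simp only
  split_ifs with h
  · have hθ : 0 < θ := by linarith
    have e : p * ((2 * θ - 1) / θ) + (1 - p) * ((1 - θ) / θ)
        = (p * (2 * θ - 1) + (1 - p) * (1 - θ)) / θ := by ring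
    rw [e]
    constructor
    · apply div_nonneg _ h0
      nlinarith
    · rw [div_le_one hθ]
      nlinarith
  · constructor <;> linarith

theorem fT_mem (p θ : I) : fT p θ ∈ I := by
  obtain ⟨p, hp0, hp1⟩ := p
  obtain ⟨θ, h0, h1⟩ := θ
  unfold fT
  simp only
  split_ifs with h
  · exact ⟨hp0, hp1⟩
  · have hθ : 0 < 1 - θ := by linarith
    have e : p * (θ / (1 - θ)) + (1 - p) * ((1 - 2 * θ) / (1 - θ))
        = (p * θ + (1 - p) * (1 - 2 * θ)) / (1 - θ) := by ring
    rw [e]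
    constructor
    · apply div_nonneg _ hθ.le
      nlinarith
    · rw [div_le_one hθ]
      nlinarith

theorem probT_mem (θ : I) (s : State) : probT θ s ∈ I := by
  obtain ⟨θ, h0, h1⟩ := θ
  cases s <;> simp only [probT] <;> split_ifs with h
  · simp
  · constructor
    · exact div_nonneg (by linarith) h0
    · rw [div_le_one (by linarith)]; linarith
  · constructor
    · exact div_nonneg (by linarith) (by linarith)
    · rw [div_le_one (by linarith)]; linarith
  · simp

/-- The internal state `θ` of Player 1 after the given moves of Player 1 (most recent first), if
it was `θ₀` at the beginning. -/
noncomputable def belief (p θ₀ : I) : List Move₁ → I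
  | [] => θ₀
  | Move₁.T :: h => ⟨fT p (belief p θ₀ h), fT_mem p _⟩
  | Move₁.B :: h => ⟨fB p (belief p θ₀ h), fB_mem p _⟩

/-- The strategy `σ*` with initial internal state `θ₀`. -/
noncomputable def sigmaStar (p θ₀ : I) : Strategy₁ := fun h s =>
  ⟨probT (belief p θ₀ (h.map fun z => z.2.1)) s, probT_mem _ s⟩

/-- `Z_n = ∑_{θ ∈ Φ⁻ⁿ(1/2)} ∏_{i < n} γ / max (Φⁱ θ, 1 - Φⁱ θ)` with `γ = 2 p - 1`, where `Φ` is
regarded as a map of the interval `[1 - p, p]` to itself. -/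
noncomputable def pressureSum (p : ℝ) (n : ℕ) : ENNReal :=
  ∑' θ : {θ : ℝ // θ ∈ Set.Icc (1 - p) p ∧ (Phi p)^[n] θ = 1 / 2},
    ∏ i ∈ Finset.range n,
      ENNReal.ofReal ((2 * p - 1) / max ((Phi p)^[i] θ) (1 - (Phi p)^[i] θ))

end AsymmetricGame

namespace AsymmetricGame

open Filter unitInterval

/-! ### The maps `fB`, `fT` and `Phi` -/

/-! The proof constructs a number v and a symmetric concave V on [1-p, p] with v + V(θ) = min(θ,
1-θ) + (1-θ) V(f_T θ) + θ V(f_B θ). If θ is the conditional probability of the state `lo`, then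
under σ* the move T has probability 1-θ, the stage gain is min(θ, 1-θ) whatever Player 2 does, and
f_T θ, f_B θ are the next conditional probabilities.

Differentiate the equation twice. For θ > 1/2 the term θ V(f_B θ) carries a kink of V at f_B(a) to a
with factor γ/a, and min(θ, 1-θ) creates a kink at 1/2. So the kink masses should satisfy m(a) = [a
= 1/2] + γ/max(a, 1-a) · m(Φ a), up to normalisation. Summing the weights of a as a preimage of 1/2
solves this (`kinkMass_eq`), and the pressure condition makes the total mass finite. Then V(x) = -c
∑ m(a)|x-a|, and `tangent p x θ` = -c ∑ m(a) sign(θ-a)(x-a) is a supporting line of V at θ. The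
change of variable `tsum_kinkMass_sign_fB` turns the recursion for m into equations between
tangents; matching at 1/2 fixes c (`curvature`) and v (`gameValue`).

Player 2 updates θ by Player 1's moves as if σ* were played, and takes as potential the tangent at θ
evaluated at the true state (x = 1 or x = 0). With `probL`, stage gain plus next potential never
exceeds v plus the present potential, in either state and for either move (`gain_add_tangent_le`).
The potential is bounded, so the sum telescopes.

For Player 1, the internal θ need not be the true conditional law, but the discrepancy shrinks by γ
at each stage (`abs_mean_deviation_le`). Since the condition excludes p = 1, the errors form a
convergent geometric series and the average gain tends to v. -/

theorem fB_of_half_le {p θ : ℝ} (h : 1 / 2 ≤ θ) : fB p θ = 3 * p - 1 - (2 * p - 1) / θ := by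
  have hθ : θ ≠ 0 := by linarith
  rw [fB, if_pos h]
  field_simp
  ring

theorem fT_one_sub (p θ : ℝ) : fT p (1 - θ) = 1 - fB p θ := by
  rcases lt_trichotomy θ (1 / 2) with h | h | h
  · rw [fT, fB, if_pos (by linarith), if_neg (by linarith)]
    ring
  · subst h
    norm_num [fT, fB]
  · have hθ : θ ≠ 0 := by linarith
    rw [fT, fB, if_neg (by linarith), if_pos h.le]
    have : 1 - (1 - θ) = θ := by ring
    rw [this]
    field_simp
    ring

theorem fB_one_sub (p θ : ℝ) : fB p (1 - θ) = 1 - fT p θ := by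
  have := fT_one_sub p (1 - θ)
  rw [sub_sub_cancel] at this
  linarith

theorem fB_half (p : ℝ) : fB p (1 / 2) = 1 - p := by
  norm_num [fB]

theorem fT_half (p : ℝ) : fT p (1 / 2) = p := by
  norm_num [fT]

theorem fB_mem_Icc {p θ : ℝ} (hp : 1 / 2 ≤ p) (hθ : θ ≤ 1) : fB p θ ∈ Set.Icc (1 - p) p := by
  by_cases h : 1 / 2 ≤ θ
  · rw [fB_of_half_le h]
    have h0 : 0 < θ := by linarith
    have h1 : (2 * p - 1) / θ ≤ (2 * p - 1) * 2 := by
      rw [div_le_iff₀ h0]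
      nlinarith
    have h2 : 2 * p - 1 ≤ (2 * p - 1) / θ := by
      rw [le_div_iff₀ h0]
      nlinarith
    constructor <;> linarith
  · rw [fB, if_neg h]
    constructor <;> linarith

theorem fT_mem_Icc {p θ : ℝ} (hp : 1 / 2 ≤ p) (hθ : 0 ≤ θ) : fT p θ ∈ Set.Icc (1 - p) p := by
  have h := fB_mem_Icc (θ := 1 - θ) hp (by linarith)
  rw [fB_one_sub] at h
  obtain ⟨h1, h2⟩ := h
  constructor <;> linarith

theorem Phi_mem_Icc {p θ : ℝ} (hp : 1 / 2 ≤ p) (h0 : 0 ≤ θ) (h1 : θ ≤ 1) :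
    Phi p θ ∈ Set.Icc (1 - p) p := by
  rw [Phi]
  split_ifs
  · exact fB_mem_Icc hp h1
  · exact fT_mem_Icc hp h0

theorem Phi_one_sub {p θ : ℝ} (h : θ ≠ 1 / 2) : Phi p (1 - θ) = 1 - Phi p θ := by
  rcases lt_or_gt_of_ne h with h | h
  · rw [Phi, Phi, if_pos (by linarith), if_neg (by linarith), fB_one_sub]
  · rw [Phi, Phi, if_neg (by linarith), if_pos h.le, fT_one_sub]

theorem fB_lt_fB {p θ τ : ℝ} (hp : 1 / 2 < p) (hθ : 1 / 2 ≤ θ) (h : θ < τ) :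
    fB p θ < fB p τ := by
  rw [fB_of_half_le hθ, fB_of_half_le (hθ.trans h.le)]
  have : (2 * p - 1) / τ < (2 * p - 1) / θ :=
    div_lt_div_of_pos_left (by linarith) (by linarith) h
  linarith

theorem sign_fB_sub_fB {p θ τ : ℝ} (hp : 1 / 2 < p) (hθ : 1 / 2 ≤ θ) (hτ : 1 / 2 ≤ τ) :
    Real.sign (fB p θ - fB p τ) = Real.sign (θ - τ) := by
  rcases lt_trichotomy θ τ with h | h | h
  · rw [Real.sign_of_neg (sub_neg.2 (fB_lt_fB hp hθ h)), Real.sign_of_neg (sub_neg.2 h)]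
  · rw [h, sub_self, sub_self]
  · rw [Real.sign_of_pos (sub_pos.2 (fB_lt_fB hp hτ h)), Real.sign_of_pos (sub_pos.2 h)]

theorem fB_image_Ioc {p : ℝ} (hp : 1 / 2 < p) :
    fB p '' Set.Ioc (1 / 2) p = Set.Ioc (1 - p) (fB p p) := by
  ext b
  constructor
  · rintro ⟨a, ⟨h1, h2⟩, rfl⟩
    refine ⟨?_, ?_⟩
    · rw [← fB_half p]
      exact fB_lt_fB hp le_rfl h1
    · rcases h2.eq_or_lt with h | h
      · rw [h]
      · exact (fB_lt_fB hp h1.le h).le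
  · rintro ⟨h1, h2⟩
    have hg : 0 < 2 * p - 1 := by linarith
    rw [fB_of_half_le hp.le] at h2
    have hpos : 0 < (2 * p - 1) / p := div_pos hg (by linarith)
    have hd : 0 < 3 * p - 1 - b := by linarith
    have ha : 1 / 2 < (2 * p - 1) / (3 * p - 1 - b) := by
      rw [lt_div_iff₀ hd]
      linarith
    -- The preimage solves 3p - 1 - γ/a = b.
    refine ⟨(2 * p - 1) / (3 * p - 1 - b), ⟨ha, ?_⟩, ?_⟩
    · rw [div_le_iff₀ hd]
      have : (2 * p - 1) / p * p = 2 * p - 1 := div_mul_cancel₀ _ (by linarith)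
      nlinarith
    · rw [fB_of_half_le ha.le, div_div_cancel₀ hg.ne']
      ring

/-! ### The kinks of the value function -/

/-- The weight `∏ γ / max (Φⁱ a, 1 - Φⁱ a)` of `a` as an `n`-th preimage of `1 / 2`, and `0` if
`a` is not one. -/
noncomputable def preimageWeight (p : ℝ) (n : ℕ) : ℝ → ENNReal :=
  Set.indicator {θ : ℝ | θ ∈ Set.Icc (1 - p) p ∧ (Phi p)^[n] θ = 1 / 2} fun θ =>
    ∏ i ∈ Finset.range n,
      ENNReal.ofReal ((2 * p - 1) / max ((Phi p)^[i] θ) (1 - (Phi p)^[i] θ))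

theorem tsum_preimageWeight (p : ℝ) (n : ℕ) : ∑' a, preimageWeight p n a = pressureSum p n := by
  rw [preimageWeight, ← tsum_subtype]
  rfl

theorem preimageWeight_of_notMem {p a : ℝ} (n : ℕ) (ha : a ∉ Set.Icc (1 - p) p) :
    preimageWeight p n a = 0 :=
  Set.indicator_of_notMem (fun h => ha h.1) _

theorem preimageWeight_of_mem {p a : ℝ} {n : ℕ} (ha : a ∈ Set.Icc (1 - p) p)
    (h : (Phi p)^[n] a = 1 / 2) :
    preimageWeight p n a = ∏ i ∈ Finset.range n,
      ENNReal.ofReal ((2 * p - 1) / max ((Phi p)^[i] a) (1 - (Phi p)^[i] a)) :=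
  Set.indicator_of_mem (s := {θ : ℝ | θ ∈ Set.Icc (1 - p) p ∧ (Phi p)^[n] θ = 1 / 2}) ⟨ha, h⟩ _

theorem preimageWeight_zero {p a : ℝ} (ha : a ∈ Set.Icc (1 - p) p) :
    preimageWeight p 0 a = if a = 1 / 2 then 1 else 0 := by
  simp only [preimageWeight, Set.indicator_apply, Set.mem_ofPred_eq, ha, true_and,
    Function.iterate_zero, id, Finset.range_zero, Finset.prod_empty]

theorem preimageWeight_succ {p a : ℝ} (n : ℕ) (hp : 1 / 2 ≤ p) (hp1 : p ≤ 1)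
    (ha : a ∈ Set.Icc (1 - p) p) :
    preimageWeight p (n + 1) a =
      ENNReal.ofReal ((2 * p - 1) / max a (1 - a)) * preimageWeight p n (Phi p a) := by
  have hPhi : Phi p a ∈ Set.Icc (1 - p) p :=
    Phi_mem_Icc hp (by linarith [ha.1]) (by linarith [ha.2])
  by_cases h : (Phi p)^[n] (Phi p a) = 1 / 2
  · rw [preimageWeight_of_mem hPhi h, preimageWeight_of_mem (n := n + 1) ha h,
      Finset.prod_range_succ', mul_comm]
    simp only [Function.iterate_succ_apply, Function.iterate_zero, id]
  · rw [preimageWeight, preimageWeight, Set.indicator_of_notMem fun h' => h h'.2,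
      Set.indicator_of_notMem fun h' => h h'.2, mul_zero]

theorem preimageWeight_one_sub {p : ℝ} (n : ℕ) (hp : 1 / 2 ≤ p) (hp1 : p ≤ 1) (a : ℝ) :
    preimageWeight p n (1 - a) = preimageWeight p n a := by
  induction n generalizing a with
  | zero =>
    by_cases ha : a ∈ Set.Icc (1 - p) p
    · have ha' : 1 - a ∈ Set.Icc (1 - p) p := ⟨by linarith [ha.2], by linarith [ha.1]⟩
      rw [preimageWeight_zero ha, preimageWeight_zero ha']
      have : 1 - a = 1 / 2 ↔ a = 1 / 2 := by constructor <;> intro h <;> linarith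
      simp only [this]
    · have ha' : 1 - a ∉ Set.Icc (1 - p) p := fun h =>
        ha ⟨by linarith [h.2], by linarith [h.1]⟩
      rw [preimageWeight_of_notMem _ ha, preimageWeight_of_notMem _ ha']
  | succ n ih =>
    by_cases ha : a ∈ Set.Icc (1 - p) p
    · have ha' : 1 - a ∈ Set.Icc (1 - p) p := ⟨by linarith [ha.2], by linarith [ha.1]⟩
      -- Φ commutes with the reflection except at 1/2, where it uses f_B; but 1/2 is its own mirror
      -- image.
      by_cases h : a = 1 / 2
      · subst h
        norm_num
      · rw [preimageWeight_succ n hp hp1 ha, preimageWeight_succ n hp hp1 ha', Phi_one_sub h, ih,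
          sub_sub_cancel, max_comm]
    · have ha' : 1 - a ∉ Set.Icc (1 - p) p := fun h =>
        ha ⟨by linarith [h.2], by linarith [h.1]⟩
      rw [preimageWeight_of_notMem _ ha, preimageWeight_of_notMem _ ha']

/-- The total weight of `a` as a preimage of `1 / 2`. -/
noncomputable def kinkMass (p a : ℝ) : ℝ :=
  (∑' n, preimageWeight p n a).toReal

theorem kinkMass_nonneg (p a : ℝ) : 0 ≤ kinkMass p a := ENNReal.toReal_nonneg

theorem tsum_tsum_preimageWeight_ne_top {p : ℝ} (hfin : ∑' n : ℕ, pressureSum p n < ⊤) :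
    ∑' a, ∑' n, preimageWeight p n a ≠ ⊤ := by
  rw [ENNReal.tsum_comm]
  simp only [tsum_preimageWeight]
  exact hfin.ne

theorem summable_kinkMass {p : ℝ} (hfin : ∑' n : ℕ, pressureSum p n < ⊤) :
    Summable (kinkMass p) :=
  ENNReal.summable_toReal (tsum_tsum_preimageWeight_ne_top hfin)

theorem kinkMass_of_notMem {p a : ℝ} (ha : a ∉ Set.Icc (1 - p) p) : kinkMass p a = 0 := by
  simp [kinkMass, preimageWeight_of_notMem _ ha]

theorem kinkMass_one_sub {p : ℝ} (hp : 1 / 2 ≤ p) (hp1 : p ≤ 1) (a : ℝ) :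
    kinkMass p (1 - a) = kinkMass p a := by
  simp only [kinkMass, preimageWeight_one_sub _ hp hp1]

/-- The term n = 0 marks the point 1/2; every later term is a weight at Φ a times the first factor
of the product. Finiteness allows passing from `ENNReal` to ℝ. -/
theorem kinkMass_eq {p a : ℝ} (hfin : ∑' n : ℕ, pressureSum p n < ⊤) (hp : 1 / 2 ≤ p)
    (hp1 : p ≤ 1) (ha : a ∈ Set.Icc (1 - p) p) :
    kinkMass p a =
      (if a = 1 / 2 then 1 else 0) + (2 * p - 1) / max a (1 - a) * kinkMass p (Phi p a) := by
  have hne : ∀ b, ∑' n, preimageWeight p n b ≠ ⊤ :=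
    ENNReal.ne_top_of_tsum_ne_top (tsum_tsum_preimageWeight_ne_top hfin)
  have h0 : 0 ≤ (2 * p - 1) / max a (1 - a) :=
    div_nonneg (by linarith) (le_max_of_le_left (by linarith [ha.1]))
  rw [kinkMass, kinkMass, tsum_eq_zero_add' ENNReal.summable]
  simp only [preimageWeight_succ _ hp hp1 ha]
  rw [ENNReal.tsum_mul_left, ENNReal.toReal_add, ENNReal.toReal_mul, ENNReal.toReal_ofReal h0,
    preimageWeight_zero ha]
  · congr 1
    split_ifs <;> simp
  · rw [preimageWeight_zero ha]
    split_ifs <;> simp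
  · exact ENNReal.mul_ne_top ENNReal.ofReal_ne_top (hne _)

theorem kinkMass_half {p : ℝ} (hfin : ∑' n : ℕ, pressureSum p n < ⊤) (hp : 1 / 2 ≤ p)
    (hp1 : p ≤ 1) : kinkMass p (1 / 2) = 1 + 2 * (2 * p - 1) * kinkMass p (1 - p) := by
  rw [kinkMass_eq hfin hp hp1 ⟨by linarith, hp⟩, Phi, if_pos le_rfl, fB_half,
    if_pos rfl, show max (1 / 2 : ℝ) (1 - 1 / 2) = 1 / 2 by norm_num]
  ring

theorem kinkMass_of_half_lt {p a : ℝ} (hfin : ∑' n : ℕ, pressureSum p n < ⊤) (hp : 1 / 2 ≤ p)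
    (hp1 : p ≤ 1) (ha : a ∈ Set.Ioc (1 / 2) p) :
    kinkMass p a = (2 * p - 1) / a * kinkMass p (fB p a) := by
  obtain ⟨h1, h2⟩ := ha
  rw [kinkMass_eq hfin hp hp1 ⟨by linarith, h2⟩, if_neg h1.ne', zero_add, Phi, if_pos h1.le,
    max_eq_left (by linarith)]

/-- Under the pressure condition, the system does not stay in its state forever. -/
theorem lt_one_of_pressureSum {p : ℝ} (hp1 : p ≤ 1) (hfin : ∑' n : ℕ, pressureSum p n < ⊤) :
    p < 1 := by
  refine lt_of_le_of_ne hp1 ?_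
  rintro rfl
  -- For p = 1 and θ < 1/2, Φ(θ) = θ/(1-θ) sends 1/(k+1) to 1/k, so 1/(n+2) reaches 1/2 in n steps.
  -- All factors are at least 1, hence each pressure sum is at least 1 and the series diverges.
  have hiter : ∀ n i : ℕ, (Phi 1)^[n] (1 / ((n + i : ℕ) + 2 : ℝ)) = 1 / ((i : ℝ) + 2) := by
    intro n i
    induction n with
    | zero => simp
    | succ n ih =>
      rw [Function.iterate_succ_apply, ← ih]
      congr 1
      have h : (0 : ℝ) ≤ ((n + i : ℕ) : ℝ) := Nat.cast_nonneg _
      have e : ((n + 1 + i : ℕ) : ℝ) = ((n + i : ℕ) : ℝ) + 1 := by push_cast; ring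
      rw [e]
      generalize ((n + i : ℕ) : ℝ) = x at h
      have hx : 1 / (x + 1 + 2) < 1 / 2 := by
        apply one_div_lt_one_div_of_lt <;> linarith
      rw [Phi, if_neg (by linarith), fT, if_neg (by linarith)]
      have h3 : 1 - 1 / (x + 1 + 2) = (x + 2) / (x + 1 + 2) := by
        field_simp
        ring
      rw [h3]
      field_simp
      ring
  have hone : ∀ n, 1 ≤ pressureSum 1 n := by
    intro n
    have hmem : 1 / ((n : ℝ) + 2) ∈ Set.Icc (1 - 1 : ℝ) 1 := by
      constructor
      · rw [sub_self]
        positivity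
      · rw [div_le_one (by positivity)]
        linarith [(Nat.cast_nonneg n : (0 : ℝ) ≤ n)]
    have hit : (Phi 1)^[n] (1 / ((n : ℝ) + 2)) = 1 / 2 := by simpa using hiter n 0
    have horb : ∀ i, (Phi 1)^[i] (1 / ((n : ℝ) + 2)) ∈ Set.Icc (1 - 1 : ℝ) 1 := by
      intro i
      induction i with
      | zero => exact hmem
      | succ i ih =>
        rw [Function.iterate_succ_apply']
        exact Phi_mem_Icc (by norm_num) (by linarith [ih.1]) ih.2
    rw [← tsum_preimageWeight]
    refine le_trans ?_ (ENNReal.le_tsum (1 / ((n : ℝ) + 2)))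
    rw [preimageWeight_of_mem hmem hit]
    refine Finset.one_le_prod' fun i _ => ?_
    rw [ENNReal.one_le_ofReal]
    obtain ⟨h0, h1⟩ := horb i
    have hpos : 0 < max ((Phi 1)^[i] (1 / ((n : ℝ) + 2))) (1 - (Phi 1)^[i] (1 / ((n : ℝ) + 2))) := by
      rw [lt_max_iff]
      by_contra! h
      linarith [h.1, h.2]
    rw [le_div_iff₀ hpos, one_mul]
    exact max_le (by linarith) (by linarith)
  have htop : ∑' _ : ℕ, (1 : ENNReal) = ⊤ := ENNReal.tsum_const_eq_top_of_ne_zero one_ne_zero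
  exact absurd (htop ▸ ENNReal.tsum_le_tsum hone) (not_le.2 hfin)

/-! ### Signed sums over the kinks and their change of variable under `fB` -/

theorem abs_sign_le_one (x : ℝ) : |Real.sign x| ≤ 1 := by
  rcases Real.sign_apply_eq x with h | h | h <;> rw [h] <;> norm_num

theorem summable_ite_eq (x : ℝ) (f : ℝ → ℝ) : Summable fun a => if a = x then f a else 0 :=
  (hasSum_single x fun _ h => if_neg h).summable

theorem summable_kinkMass_mul {p K : ℝ} {φ : ℝ → ℝ} (hfin : ∑' n : ℕ, pressureSum p n < ⊤)
    (hφ : ∀ a ∈ Set.Icc (1 - p) p, |φ a| ≤ K) : Summable fun a => kinkMass p a * φ a := by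
  refine Summable.of_norm_bounded ((summable_kinkMass hfin).mul_right K) fun a => ?_
  by_cases ha : a ∈ Set.Icc (1 - p) p
  · rw [Real.norm_eq_abs, abs_mul, abs_of_nonneg (kinkMass_nonneg p a)]
    exact mul_le_mul_of_nonneg_left (hφ a ha) (kinkMass_nonneg p a)
  · simp [kinkMass_of_notMem ha]

theorem summable_kinkMass_mul_sign {p K : ℝ} {φ : ℝ → ℝ}
    (hfin : ∑' n : ℕ, pressureSum p n < ⊤) (hφ : ∀ a ∈ Set.Icc (1 - p) p, |φ a| ≤ K) (θ : ℝ) :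
    Summable fun a => kinkMass p a * (Real.sign (θ - a) * φ a) := by
  refine summable_kinkMass_mul (K := K) hfin fun a ha => ?_
  rw [abs_mul]
  exact (mul_le_of_le_one_left (abs_nonneg _) (abs_sign_le_one _)).trans (hφ a ha)

/-- The kinks above `1 / 2` are the images of kinks under the inverse of `fB`. -/
theorem tsum_indicator_kinkMass {p : ℝ} {φ ψ : ℝ → ℝ} (hfin : ∑' n : ℕ, pressureSum p n < ⊤)
    (hp : 1 / 2 < p) (hp1 : p ≤ 1)
    (h : ∀ a ∈ Set.Ioc (1 / 2) p, φ (fB p a) = ψ a * ((2 * p - 1) / a)) :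
    ∑' b, (Set.Ioc (1 - p) (fB p p)).indicator (fun b => kinkMass p b * φ b) b =
      ∑' a, (Set.Ioc (1 / 2) p).indicator (fun a => kinkMass p a * ψ a) a := by
  have hinj : Set.InjOn (fB p) (Set.Ioc (1 / 2) p) := by
    intro a ha b hb hab
    rcases lt_trichotomy a b with h | h | h
    · exact absurd hab (fB_lt_fB hp ha.1.le h).ne
    · exact h
    · exact absurd hab (fB_lt_fB hp hb.1.le h).ne'
  rw [← fB_image_Ioc hp, ← tsum_subtype, ← tsum_subtype,
    tsum_image (fun b => kinkMass p b * φ b) hinj]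
  refine tsum_congr fun a => ?_
  rw [h a a.2, kinkMass_of_half_lt hfin hp.le hp1 a.2]
  ring

/-- Substitute b = f_B(a), which preserves the sign and multiplies the mass by a/γ; the hypothesis
on φ and ψ absorbs this factor. The points 1-p = f_B(1/2) and 1/2 are ends of the intervals and give
the separate terms. -/
theorem tsum_kinkMass_sign_fB {p K θ : ℝ} {φ ψ : ℝ → ℝ}
    (hfin : ∑' n : ℕ, pressureSum p n < ⊤) (hp1 : p ≤ 1) (hθ : θ ∈ Set.Ioc (1 / 2) p)
    (hφ : ∀ a ∈ Set.Icc (1 - p) p, |φ a| ≤ K) (hψ : ∀ a ∈ Set.Icc (1 - p) p, |ψ a| ≤ K)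
    (h : ∀ a ∈ Set.Ioc (1 / 2) p, φ (fB p a) = ψ a * ((2 * p - 1) / a)) :
    ∑' b, kinkMass p b * (Real.sign (fB p θ - b) * φ b) + ∑' b, kinkMass p b * φ b =
      ∑' a, kinkMass p a * (Real.sign (θ - a) * ψ a) -
        ∑' a, kinkMass p a * (Real.sign (1 / 2 - a) * ψ a) -
        kinkMass p (1 / 2) * ψ (1 / 2) + 2 * (kinkMass p (1 - p) * φ (1 - p)) := by
  have hp : 1 / 2 < p := hθ.1.trans_le hθ.2
  have hle : fB p θ ≤ fB p p := by
    rcases hθ.2.eq_or_lt with h | h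
    · rw [h]
    · exact (fB_lt_fB hp hθ.1.le h).le
  have hlt : 1 - p < fB p θ := by
    rw [← fB_half p]
    exact fB_lt_fB hp le_rfl hθ.1
  -- Adding 1 to the sign removes the kinks above f_B(θ), in particular those beyond f_B(p), which
  -- have no preimage in (1/2, p].
  have hmid := tsum_indicator_kinkMass (φ := fun b => (Real.sign (fB p θ - b) + 1) * φ b)
    (ψ := fun a => (Real.sign (θ - a) + 1) * ψ a) hfin hp hp1 (fun a ha => by
      rw [sign_fB_sub_fB hp hθ.1.le ha.1.le, h a ha]
      ring)
  have sφ := summable_kinkMass_mul hfin hφ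
  have ssφ := summable_kinkMass_mul_sign hfin hφ (fB p θ)
  have sψ := summable_kinkMass_mul hfin hψ
  have ssψ := summable_kinkMass_mul_sign hfin hψ θ
  have hsψ := summable_kinkMass_mul_sign hfin hψ (1 / 2)
  have s₁ : Summable ((Set.Ioc (1 - p) (fB p p)).indicator
      fun b => kinkMass p b * ((Real.sign (fB p θ - b) + 1) * φ b)) := by
    refine Summable.indicator ((ssφ.add sφ).congr fun b => ?_) _
    ring
  have s₂ : Summable ((Set.Ioc (1 / 2) p).indicator
      fun a => kinkMass p a * ((Real.sign (θ - a) + 1) * ψ a)) := by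
    refine Summable.indicator ((ssψ.add sψ).congr fun b => ?_) _
    ring
  have e₁ : ∑' b, kinkMass p b * (Real.sign (fB p θ - b) * φ b) + ∑' b, kinkMass p b * φ b =
      ∑' b, (Set.Ioc (1 - p) (fB p p)).indicator
        (fun b => kinkMass p b * ((Real.sign (fB p θ - b) + 1) * φ b)) b +
        2 * (kinkMass p (1 - p) * φ (1 - p)) := by
    rw [← ssφ.tsum_add sφ, ← tsum_ite_eq (1 - p) fun b => 2 * (kinkMass p b * φ b),
      ← s₁.tsum_add (summable_ite_eq (1 - p) _)]
    refine tsum_congr fun b => ?_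
    by_cases hb : b ∈ Set.Icc (1 - p) p
    · rcases hb.1.eq_or_lt with hb' | hb'
      · rw [Set.indicator_of_notMem (fun h => absurd h.1 (by rw [← hb']; exact lt_irrefl _)),
          if_pos hb'.symm, Real.sign_of_pos (by linarith)]
        ring
      · rw [if_neg hb'.ne']
        by_cases hb'' : b ≤ fB p p
        · rw [Set.indicator_of_mem (Set.mem_Ioc.2 ⟨hb', hb''⟩)]
          ring
        · rw [Set.indicator_of_notMem (fun h => hb'' h.2), Real.sign_of_neg (by linarith)]
          ring
    · have hb' : b ≠ 1 - p := fun h => hb ⟨h.ge, by linarith⟩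
      simp [Set.indicator_apply, kinkMass_of_notMem hb, hb']
  have e₂ : ∑' a, kinkMass p a * (Real.sign (θ - a) * ψ a) -
        ∑' a, kinkMass p a * (Real.sign (1 / 2 - a) * ψ a) =
      ∑' a, (Set.Ioc (1 / 2) p).indicator
        (fun a => kinkMass p a * ((Real.sign (θ - a) + 1) * ψ a)) a +
        kinkMass p (1 / 2) * ψ (1 / 2) := by
    rw [← ssψ.tsum_sub hsψ, ← tsum_ite_eq (1 / 2) fun a => kinkMass p a * ψ a,
      ← s₂.tsum_add (summable_ite_eq (1 / 2) _)]
    refine tsum_congr fun a => ?_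
    by_cases ha : a ∈ Set.Icc (1 - p) p
    · rcases lt_trichotomy a (1 / 2) with ha' | ha' | ha'
      · rw [Set.indicator_of_notMem (fun h => absurd h.1 ha'.not_gt), if_neg ha'.ne,
          Real.sign_of_pos (sub_pos.2 (ha'.trans hθ.1)), Real.sign_of_pos (sub_pos.2 ha')]
        ring
      · rw [Set.indicator_of_notMem (fun h => absurd h.1 ha'.not_gt), if_pos ha',
          Real.sign_of_pos (by linarith [hθ.1]), ha', sub_self, Real.sign_zero]
        ring
      · rw [Set.indicator_of_mem (Set.mem_Ioc.2 ⟨ha', ha.2⟩), if_neg ha'.ne',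
          Real.sign_of_neg (sub_neg.2 ha')]
        ring
    · have ha' : a ≠ 1 / 2 := fun h => ha ⟨by linarith, by linarith⟩
      simp only [kinkMass_of_notMem ha, Set.indicator_apply, zero_mul, ha', ite_self,
        sub_self, add_zero]
  rw [e₁, e₂, hmid]
  ring

/-! ### The tangents of the value function -/

/-- The total mass of the kinks. -/
noncomputable def kinkTotal (p : ℝ) : ℝ := ∑' a, kinkMass p a

/-- The mass of the kinks below `θ` minus the mass of the kinks above `θ`. -/
noncomputable def kinkBalance (p θ : ℝ) : ℝ := ∑' a, kinkMass p a * Real.sign (θ - a)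

/-- The first moment of the kinks below `θ` minus that of the kinks above `θ`. -/
noncomputable def kinkMoment (p θ : ℝ) : ℝ := ∑' a, kinkMass p a * (Real.sign (θ - a) * a)

theorem abs_le_one_of_mem {p : ℝ} {a : ℝ} (hp1 : p ≤ 1) (ha : a ∈ Set.Icc (1 - p) p) : |a| ≤ 1 :=
  abs_le.2 ⟨by linarith [ha.1], by linarith [ha.2]⟩

theorem summable_kinkBalance {p : ℝ} (hfin : ∑' n : ℕ, pressureSum p n < ⊤) (θ : ℝ) :
    Summable fun a => kinkMass p a * Real.sign (θ - a) :=
  summable_kinkMass_mul hfin fun _ _ => abs_sign_le_one _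

theorem summable_kinkMoment {p : ℝ} (hfin : ∑' n : ℕ, pressureSum p n < ⊤) (hp1 : p ≤ 1) (θ : ℝ) :
    Summable fun a => kinkMass p a * (Real.sign (θ - a) * a) :=
  summable_kinkMass_mul_sign (φ := id) hfin (fun _ ha => abs_le_one_of_mem hp1 ha) θ

theorem summable_kinkMass_mul_self {p : ℝ} (hfin : ∑' n : ℕ, pressureSum p n < ⊤) (hp1 : p ≤ 1) :
    Summable fun a => kinkMass p a * a :=
  summable_kinkMass_mul (φ := id) hfin (fun _ ha => abs_le_one_of_mem hp1 ha)

theorem tsum_kinkMass_affine {p : ℝ} (hfin : ∑' n : ℕ, pressureSum p n < ⊤) (hp1 : p ≤ 1)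
    (x y : ℝ) :
    ∑' a, kinkMass p a * (x + y * a) = x * kinkTotal p + y * ∑' a, kinkMass p a * a := by
  rw [kinkTotal, ← tsum_mul_left, ← tsum_mul_left, ← ((summable_kinkMass hfin).mul_left x).tsum_add
    ((summable_kinkMass_mul_self hfin hp1).mul_left y)]
  exact tsum_congr fun a => by ring

theorem tsum_kinkMass_sign_affine {p : ℝ} (hfin : ∑' n : ℕ, pressureSum p n < ⊤) (hp1 : p ≤ 1)
    (θ x y : ℝ) :
    ∑' a, kinkMass p a * (Real.sign (θ - a) * (x + y * a)) =
      x * kinkBalance p θ + y * kinkMoment p θ := by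
  rw [kinkBalance, kinkMoment, ← tsum_mul_left, ← tsum_mul_left,
    ← ((summable_kinkBalance hfin θ).mul_left x).tsum_add
      ((summable_kinkMoment hfin hp1 θ).mul_left y)]
  exact tsum_congr fun a => by ring

/-- The masses are symmetric under a ↦ 1-a, so their barycentre is 1/2. -/
theorem tsum_kinkMass_mul_self {p : ℝ} (hfin : ∑' n : ℕ, pressureSum p n < ⊤) (hp : 1 / 2 ≤ p)
    (hp1 : p ≤ 1) : ∑' a, kinkMass p a * a = kinkTotal p / 2 := by
  have h : ∑' a, kinkMass p a * a = ∑' a, kinkMass p a * (1 + (-1) * a) := by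
    rw [← (Equiv.subLeft (1 : ℝ)).tsum_eq fun a => kinkMass p a * a]
    refine tsum_congr fun a => ?_
    rw [Equiv.subLeft_apply, kinkMass_one_sub hp hp1]
    ring
  rw [tsum_kinkMass_affine hfin hp1] at h
  linarith

theorem kinkBalance_one_sub {p : ℝ} (hp : 1 / 2 ≤ p) (hp1 : p ≤ 1)
    (θ : ℝ) : kinkBalance p (1 - θ) = -kinkBalance p θ := by
  rw [kinkBalance, kinkBalance, ← tsum_neg, ← (Equiv.subLeft (1 : ℝ)).tsum_eq]
  refine tsum_congr fun a => ?_
  rw [Equiv.subLeft_apply, kinkMass_one_sub hp hp1, ← mul_neg, ← Real.sign_neg]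
  congr 2
  ring

theorem kinkMoment_one_sub {p : ℝ} (hfin : ∑' n : ℕ, pressureSum p n < ⊤) (hp : 1 / 2 ≤ p)
    (hp1 : p ≤ 1) (θ : ℝ) :
    kinkMoment p (1 - θ) = kinkMoment p θ - kinkBalance p θ := by
  have h := tsum_kinkMass_sign_affine hfin hp1 θ (-1) 1
  rw [kinkMoment, ← (Equiv.subLeft (1 : ℝ)).tsum_eq]
  have e : ∀ a, kinkMass p (Equiv.subLeft (1 : ℝ) a) *
      (Real.sign (1 - θ - Equiv.subLeft (1 : ℝ) a) * Equiv.subLeft (1 : ℝ) a) =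
      kinkMass p a * (Real.sign (θ - a) * (-1 + 1 * a)) := by
    intro a
    rw [Equiv.subLeft_apply, kinkMass_one_sub hp hp1,
      show 1 - θ - (1 - a) = -(θ - a) by ring, Real.sign_neg]
    ring
  rw [tsum_congr e, h]
  ring

theorem kinkBalance_half {p : ℝ} (hp : 1 / 2 ≤ p) (hp1 : p ≤ 1) : kinkBalance p (1 / 2) = 0 := by
  have h := kinkBalance_one_sub hp hp1 (1 / 2)
  norm_num at h ⊢
  linarith

/-! ### Bounds and endpoint values of the balance and the moment -/

theorem kinkMass_le_kinkTotal {p : ℝ} (hfin : ∑' n : ℕ, pressureSum p n < ⊤)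
    (a : ℝ) : kinkMass p a ≤ kinkTotal p :=
  (summable_kinkMass hfin).le_tsum a fun b _ => kinkMass_nonneg p b

theorem abs_kinkBalance_le {p : ℝ} (hfin : ∑' n : ℕ, pressureSum p n < ⊤)
    (θ : ℝ) : |kinkBalance p θ| ≤ kinkTotal p := by
  rw [← Real.norm_eq_abs]
  refine tsum_of_norm_bounded (summable_kinkMass hfin).hasSum fun a => ?_
  rw [norm_mul, Real.norm_of_nonneg (kinkMass_nonneg p a)]
  exact mul_le_of_le_one_right (kinkMass_nonneg p a) (abs_sign_le_one _)

theorem abs_kinkMoment_le {p : ℝ} (hfin : ∑' n : ℕ, pressureSum p n < ⊤) (hp1 : p ≤ 1)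
    (θ : ℝ) : |kinkMoment p θ| ≤ kinkTotal p := by
  rw [← Real.norm_eq_abs]
  refine tsum_of_norm_bounded (summable_kinkMass hfin).hasSum fun a => ?_
  by_cases ha : a ∈ Set.Icc (1 - p) p
  · rw [norm_mul, norm_mul, Real.norm_of_nonneg (kinkMass_nonneg p a)]
    exact mul_le_of_le_one_right (kinkMass_nonneg p a)
      (mul_le_one₀ (abs_sign_le_one _) (abs_nonneg _) (abs_le_one_of_mem hp1 ha))
  · simp [kinkMass_of_notMem ha]

theorem kinkBalance_right {p : ℝ} (hfin : ∑' n : ℕ, pressureSum p n < ⊤)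
    : kinkBalance p p = kinkTotal p - kinkMass p p := by
  rw [kinkBalance, kinkTotal, ← tsum_ite_eq p (kinkMass p),
    ← (summable_kinkMass hfin).tsum_sub (summable_ite_eq p _)]
  refine tsum_congr fun a => ?_
  rcases lt_trichotomy a p with h | h | h
  · rw [Real.sign_of_pos (sub_pos.2 h), if_neg h.ne]
    ring
  · rw [h, sub_self, Real.sign_zero, if_pos rfl]
    ring
  · rw [kinkMass_of_notMem fun h' => absurd h'.2 h.not_ge, if_neg h.ne']
    ring

theorem kinkMoment_right {p : ℝ} (hfin : ∑' n : ℕ, pressureSum p n < ⊤) (hp : 1 / 2 ≤ p)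
    (hp1 : p ≤ 1) :
    p * kinkBalance p p - kinkMoment p p = (p - 1 / 2) * kinkTotal p := by
  have h1 := tsum_kinkMass_sign_affine hfin hp1 p p (-1)
  have h2 := tsum_kinkMass_affine hfin hp1 p (-1)
  have e : ∑' a, kinkMass p a * (Real.sign (p - a) * (p + -1 * a)) =
      ∑' a, kinkMass p a * (p + -1 * a) := by
    refine tsum_congr fun a => ?_
    rcases lt_trichotomy a p with h | h | h
    · rw [Real.sign_of_pos (sub_pos.2 h), one_mul]
    · rw [h]
      ring
    · rw [kinkMass_of_notMem fun h' => absurd h'.2 h.not_ge]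
      ring
  rw [tsum_kinkMass_mul_self hfin hp hp1] at h2
  linarith

theorem kinkMoment_left {p : ℝ} (hfin : ∑' n : ℕ, pressureSum p n < ⊤) (hp : 1 / 2 ≤ p)
    (hp1 : p ≤ 1) :
    p * kinkBalance p (1 - p) - kinkMoment p (1 - p) =
      (2 * p - 1) * kinkMass p (1 - p) - (p - 1 / 2) * kinkTotal p := by
  have h1 := kinkMoment_right hfin hp hp1
  rw [kinkMoment_one_sub hfin hp hp1, kinkBalance_one_sub hp hp1]
  have h2 := kinkBalance_right hfin
  have h3 := kinkMass_one_sub hp hp1 p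
  rw [h3]
  linear_combination h1 + (1 - 2 * p) * h2

theorem kinkMoment_le {p : ℝ} (hfin : ∑' n : ℕ, pressureSum p n < ⊤) (hp : 1 / 2 ≤ p) (hp1 : p ≤ 1)
    (τ : ℝ) :
    p * kinkBalance p τ - kinkMoment p τ ≤ (p - 1 / 2) * kinkTotal p := by
  have h1 := tsum_kinkMass_sign_affine hfin hp1 τ p (-1)
  have h2 := tsum_kinkMass_affine hfin hp1 p (-1)
  rw [tsum_kinkMass_mul_self hfin hp hp1] at h2
  have hb : ∀ a ∈ Set.Icc (1 - p) p, |p + -1 * a| ≤ 1 := fun a ha =>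
    abs_le.2 ⟨by linarith [ha.2], by linarith [ha.1]⟩
  have h3 : ∑' a, kinkMass p a * (Real.sign (τ - a) * (p + -1 * a)) ≤
      ∑' a, kinkMass p a * (p + -1 * a) := by
    refine (summable_kinkMass_mul_sign hfin hb τ).tsum_le_tsum (fun a => ?_)
      (summable_kinkMass_mul hfin hb)
    by_cases ha : a ∈ Set.Icc (1 - p) p
    · exact mul_le_mul_of_nonneg_left
        (mul_le_of_le_one_left (by linarith [ha.2]) (abs_le.1 (abs_sign_le_one _)).2)
        (kinkMass_nonneg p a)
    · simp [kinkMass_of_notMem ha]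
  linarith

/-- In ∑ m(a)(sign(τ-a) + 1)(p-a) all terms are nonnegative; only the one at a = 1-p is kept. -/
theorem le_kinkMoment {p : ℝ} (hfin : ∑' n : ℕ, pressureSum p n < ⊤) (hp : 1 / 2 ≤ p) (hp1 : p ≤ 1)
    {τ : ℝ} (hτ : 1 - p < τ) :
    2 * (2 * p - 1) * kinkMass p (1 - p) - (p - 1 / 2) * kinkTotal p ≤
      p * kinkBalance p τ - kinkMoment p τ := by
  have h1 := tsum_kinkMass_sign_affine hfin hp1 τ p (-1)
  have h2 := tsum_kinkMass_affine hfin hp1 p (-1)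
  rw [tsum_kinkMass_mul_self hfin hp hp1] at h2
  have hb : ∀ a ∈ Set.Icc (1 - p) p, |p + -1 * a| ≤ 1 := fun a ha =>
    abs_le.2 ⟨by linarith [ha.2], by linarith [ha.1]⟩
  have s1 := summable_kinkMass_mul_sign hfin hb τ
  have s2 := summable_kinkMass_mul hfin hb
  have h3 := (s1.add s2).le_tsum (1 - p) (fun a _ => by
    by_cases ha : a ∈ Set.Icc (1 - p) p
    · have h4 : 0 ≤ Real.sign (τ - a) + 1 := by
        linarith [(abs_le.1 (abs_sign_le_one (τ - a))).1]
      have h5 : 0 ≤ p + -1 * a := by linarith [ha.2]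
      have := mul_nonneg (kinkMass_nonneg p a) (mul_nonneg h4 h5)
      linarith
    · simp [kinkMass_of_notMem ha])
  rw [s1.tsum_add s2, h1, h2, Real.sign_of_pos (sub_pos.2 hτ)] at h3
  linarith

theorem le_kinkBalance {p : ℝ} (hfin : ∑' n : ℕ, pressureSum p n < ⊤) {τ : ℝ} (hτ : 1 - p < τ) :
    2 * kinkMass p (1 - p) - kinkTotal p ≤ kinkBalance p τ := by
  have s1 := summable_kinkBalance hfin τ
  have s2 := summable_kinkMass hfin
  have h3 := (s1.add s2).le_tsum (1 - p) (fun a _ => by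
    have h4 : 0 ≤ Real.sign (τ - a) + 1 := by
      linarith [(abs_le.1 (abs_sign_le_one (τ - a))).1]
    have := mul_nonneg (kinkMass_nonneg p a) h4
    linarith)
  rw [s1.tsum_add s2, Real.sign_of_pos (sub_pos.2 hτ)] at h3
  rw [kinkBalance, kinkTotal]
  linarith

/-! ### Functional equations under `fB`, and the tangents -/

theorem kinkBalance_fB {p : ℝ} (hfin : ∑' n : ℕ, pressureSum p n < ⊤) (hp1 : p ≤ 1)
    {θ : ℝ} (hθ : θ ∈ Set.Ioc (1 / 2) p) :
    (3 * p - 1) * kinkBalance p (fB p θ) - kinkMoment p (fB p θ) =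
      kinkBalance p θ - 3 * (p - 1 / 2) * kinkTotal p - 1 +
        2 * (2 * p - 1) * kinkMass p (1 - p) := by
  have hp : 1 / 2 ≤ p := (hθ.1.trans_le hθ.2).le
  -- This φ satisfies φ(f_B a) = γ/a, so ψ = 1.
  have key := tsum_kinkMass_sign_fB (K := 2) (φ := fun b => 3 * p - 1 + -1 * b)
    (ψ := fun a => 1 + 0 * a) hfin hp1 hθ
    (fun a ha => abs_le.2 ⟨by linarith [ha.2], by linarith [ha.1]⟩)
    (fun a _ => by norm_num)
    (fun a ha => by rw [fB_of_half_le ha.1.le]; ring)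
  simp only [tsum_kinkMass_sign_affine hfin hp1, tsum_kinkMass_affine hfin hp1,
    tsum_kinkMass_mul_self hfin hp hp1, kinkBalance_half hp hp1,
    kinkMass_half hfin hp hp1] at key
  linarith

theorem kinkMoment_fB {p : ℝ} (hfin : ∑' n : ℕ, pressureSum p n < ⊤) (hp1 : p ≤ 1)
    {θ : ℝ} (hθ : θ ∈ Set.Ioc (1 / 2) p) :
    p * kinkBalance p (fB p θ) - kinkMoment p (fB p θ) =
      kinkBalance p θ - kinkMoment p θ + kinkMoment p (1 / 2) - (p - 1 / 2) * kinkTotal p -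
        1 / 2 + (2 * p - 1) * kinkMass p (1 - p) := by
  have hp : 1 / 2 ≤ p := (hθ.1.trans_le hθ.2).le
  -- This φ satisfies φ(f_B a) = (1-a) γ/a, so ψ(a) = 1-a.
  have key := tsum_kinkMass_sign_fB (K := 2) (φ := fun b => p + -1 * b)
    (ψ := fun a => 1 + -1 * a) hfin hp1 hθ
    (fun a ha => abs_le.2 ⟨by linarith [ha.2], by linarith [ha.1]⟩)
    (fun a ha => abs_le.2 ⟨by linarith [ha.2], by linarith [ha.1]⟩)
    (fun a ha => by
      have : a ≠ 0 := by linarith [ha.1]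
      rw [fB_of_half_le ha.1.le]
      field_simp
      ring)
  simp only [tsum_kinkMass_sign_affine hfin hp1, tsum_kinkMass_affine hfin hp1,
    tsum_kinkMass_mul_self hfin hp hp1, kinkBalance_half hp hp1,
    kinkMass_half hfin hp hp1] at key
  linarith

/-- The factor that makes the mass of the kinks the curvature of the value function. -/
noncomputable def curvature (p : ℝ) : ℝ :=
  (1 + 2 * (2 * p - 1) * (kinkTotal p - kinkMass p (1 - p)))⁻¹

/-- The value at `x` of the tangent at `θ` to the concave function with the given kinks. -/
noncomputable def tangent (p x θ : ℝ) : ℝ :=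
  -curvature p * (x * kinkBalance p θ - kinkMoment p θ)

/-- The value of the game. -/
noncomputable def gameValue (p : ℝ) : ℝ :=
  1 / 2 + tangent p p p - tangent p 1 (1 / 2)

theorem tangent_affine (p x θ : ℝ) :
    tangent p x θ = x * tangent p 1 θ + (1 - x) * tangent p 0 θ := by
  rw [tangent, tangent, tangent]
  ring

theorem tangent_one_sub {p : ℝ} (hfin : ∑' n : ℕ, pressureSum p n < ⊤) (hp : 1 / 2 ≤ p)
    (hp1 : p ≤ 1) (x θ : ℝ) : tangent p (1 - x) (1 - θ) = tangent p x θ := by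
  rw [tangent, tangent, kinkMoment_one_sub hfin hp hp1, kinkBalance_one_sub hp hp1]
  ring

theorem curvature_denom_pos {p : ℝ} (hfin : ∑' n : ℕ, pressureSum p n < ⊤) (hp : 1 / 2 ≤ p) :
    0 < 1 + 2 * (2 * p - 1) * (kinkTotal p - kinkMass p (1 - p)) := by
  have h1 := kinkMass_le_kinkTotal hfin (1 - p)
  have h2 : 0 ≤ 2 * p - 1 := by linarith
  nlinarith [mul_nonneg h2 (sub_nonneg.2 h1)]

theorem curvature_pos {p : ℝ} (hfin : ∑' n : ℕ, pressureSum p n < ⊤) (hp : 1 / 2 ≤ p)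
    : 0 < curvature p := inv_pos.2 (curvature_denom_pos hfin hp)

theorem curvature_mul {p : ℝ} (hfin : ∑' n : ℕ, pressureSum p n < ⊤) (hp : 1 / 2 ≤ p) :
    curvature p * (1 + 2 * (2 * p - 1) * (kinkTotal p - kinkMass p (1 - p))) = 1 :=
  inv_mul_cancel₀ (curvature_denom_pos hfin hp).ne'

theorem exists_abs_tangent_le {p : ℝ} (hfin : ∑' n : ℕ, pressureSum p n < ⊤) (hp : 1 / 2 ≤ p)
    (hp1 : p ≤ 1) :
    ∃ K, ∀ x ∈ Set.Icc (0 : ℝ) 1, ∀ θ, |tangent p x θ| ≤ K := by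
  refine ⟨curvature p * (2 * kinkTotal p), fun x hx θ => ?_⟩
  rw [tangent, abs_mul, abs_neg, abs_of_pos (curvature_pos hfin hp)]
  refine mul_le_mul_of_nonneg_left ?_ (curvature_pos hfin hp).le
  refine (abs_sub _ _).trans ?_
  have h1 := abs_kinkBalance_le hfin θ
  have h2 := abs_kinkMoment_le hfin hp1 θ
  have h3 : |x * kinkBalance p θ| ≤ |kinkBalance p θ| := by
    rw [abs_mul, abs_of_nonneg hx.1]
    exact mul_le_of_le_one_left (abs_nonneg _) hx.2
  linarith

/-- Optimality equation for move B in state `lo`: no gain, and the next state is `lo` with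
probability p. -/
theorem gameValue_add_tangent_one {p : ℝ} (hfin : ∑' n : ℕ, pressureSum p n < ⊤) (hp1 : p ≤ 1)
    {θ : ℝ} (hθ : θ ∈ Set.Ioc (1 / 2) p) :
    gameValue p + tangent p 1 θ = tangent p p (fB p θ) := by
  have hp : 1 / 2 ≤ p := (hθ.1.trans_le hθ.2).le
  have h1 := kinkMoment_fB hfin hp1 hθ
  have h2 := kinkMoment_right hfin hp hp1
  have h3 := curvature_mul hfin hp
  have h4 := kinkBalance_half hp hp1
  simp only [gameValue, tangent]
  linear_combination curvature p * h1 - curvature p * h2 - 1 / 2 * h3 + curvature p * h4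

/-- Optimality equation for move B in state `hi`: the gain is the probability 1 - `probL` of R. -/
theorem gameValue_add_tangent_zero {p : ℝ} (hfin : ∑' n : ℕ, pressureSum p n < ⊤) (hp1 : p ≤ 1)
    {θ : ℝ} (hθ : θ ∈ Set.Ioc (1 / 2) p) :
    gameValue p + tangent p 0 θ =
      1 - (tangent p p (fB p θ) - tangent p p p) + tangent p (1 - p) (fB p θ) := by
  have hp : 1 / 2 ≤ p := (hθ.1.trans_le hθ.2).le
  have h0 := gameValue_add_tangent_one hfin hp1 hθ
  have h1 := kinkBalance_fB hfin hp1 hθ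
  have h2 := kinkMoment_right hfin hp hp1
  have h3 := curvature_mul hfin hp
  simp only [tangent] at h0 ⊢
  linear_combination h0 - curvature p * h1 + curvature p * h2 + h3

/-- By concavity the tangent at p is lowest at the point p. With `tangent_sub_le_one`, this makes
`probL` a probability. -/
theorem tangent_sub_nonneg {p : ℝ} (hfin : ∑' n : ℕ, pressureSum p n < ⊤) (hp : 1 / 2 ≤ p)
    (hp1 : p ≤ 1) (τ : ℝ) : 0 ≤ tangent p p τ - tangent p p p := by
  have h1 := kinkMoment_le hfin hp hp1 τ
  rw [← kinkMoment_right hfin hp hp1] at h1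
  have h2 := mul_le_mul_of_nonneg_left h1 (curvature_pos hfin hp).le
  simp only [tangent]
  linarith

theorem kinkTotal_nonneg {p : ℝ} (hp : 1 / 2 ≤ p) : 0 ≤ (2 * p - 1) * kinkTotal p :=
  mul_nonneg (by linarith) (tsum_nonneg (kinkMass_nonneg p))

theorem tangent_sub_le_one {p : ℝ} (hfin : ∑' n : ℕ, pressureSum p n < ⊤) (hp : 1 / 2 ≤ p)
    (hp1 : p ≤ 1) {τ : ℝ} (hτ : 1 - p < τ) : tangent p p τ - tangent p p p ≤ 1 := by
  have h1 := le_kinkMoment hfin hp hp1 hτ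
  have h2 := kinkMoment_right hfin hp hp1
  have h3 := curvature_mul hfin hp
  have h4 := kinkTotal_nonneg hp
  have h5 : (p * kinkBalance p p - kinkMoment p p) - (p * kinkBalance p τ - kinkMoment p τ) ≤
      1 + 2 * (2 * p - 1) * (kinkTotal p - kinkMass p (1 - p)) := by
    linarith
  have h6 := mul_le_mul_of_nonneg_left h5 (curvature_pos hfin hp).le
  simp only [tangent]
  linarith

/-- Move T in state `hi`, which σ* avoids when θ > 1/2: it gains nothing and does not improve the
potential enough. -/
theorem tangent_right_le {p : ℝ} (hfin : ∑' n : ℕ, pressureSum p n < ⊤) (hp1 : p ≤ 1)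
    {θ : ℝ} (hθ : θ ∈ Set.Ioc (1 / 2) p) :
    tangent p (1 - p) p ≤ gameValue p + tangent p 0 θ := by
  have hp : 1 / 2 < p := hθ.1.trans_le hθ.2
  have hτ : 1 - p < fB p θ := by
    rw [← fB_half p]
    exact fB_lt_fB hp le_rfl hθ.1
  have h1 := le_kinkBalance hfin hτ
  have h2 := kinkBalance_right hfin
  rw [← kinkMass_one_sub hp.le hp1] at h2
  have h3 := curvature_mul hfin hp.le
  have h4 : 0 ≤ (2 * p - 1) * kinkMass p (1 - p) :=
    mul_nonneg (by linarith) (kinkMass_nonneg p _)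
  have h5 : 0 ≤ 1 + (2 * p - 1) * (kinkBalance p (fB p θ) - kinkBalance p p) +
      2 * (2 * p - 1) * (kinkTotal p - kinkMass p (1 - p)) := by
    nlinarith [mul_le_mul_of_nonneg_left h1 (by linarith : 0 ≤ 2 * p - 1)]
  have h6 := mul_nonneg (curvature_pos hfin hp.le).le h5
  rw [gameValue_add_tangent_zero hfin hp1 hθ]
  simp only [tangent]
  linarith

/-- The case θ = 1/2, move B in state `lo`. -/
theorem tangent_left_le {p : ℝ} (hfin : ∑' n : ℕ, pressureSum p n < ⊤) (hp : 1 / 2 ≤ p)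
    (hp1 : p ≤ 1) : tangent p p (1 - p) ≤ 1 / 2 + tangent p p p := by
  have h1 := kinkMoment_left hfin hp hp1
  have h2 := kinkMoment_right hfin hp hp1
  have h3 := curvature_mul hfin hp
  have h4 := curvature_pos hfin hp
  simp only [tangent]
  nlinarith

/-! ### Expectations under the law of a play -/

/-- The expectation of `F` under `μ`. -/
noncomputable def mean {α : Type} (μ : PMF α) (F : α → ℝ) : ℝ :=
  ∑' z, (μ z).toReal * F z

/-- Only finitely many plays of a given length have positive probability, so no integrability
condition on F is needed. -/
theorem summable_mean {α : Type} {μ : PMF α} (hμ : μ.support.Finite) (F : α → ℝ) :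
    Summable fun z => (μ z).toReal * F z := by
  refine summable_of_hasFiniteSupport (hμ.subset fun z hz => ?_)
  rw [PMF.mem_support_iff]
  rintro h
  exact hz (by simp [h])

theorem mean_add {α : Type} {μ : PMF α} (hμ : μ.support.Finite) (F G : α → ℝ) :
    mean μ (fun z => F z + G z) = mean μ F + mean μ G := by
  rw [mean, mean, mean, ← (summable_mean hμ F).tsum_add (summable_mean hμ G)]
  exact tsum_congr fun z => mul_add _ _ _

theorem mean_const {α : Type} (μ : PMF α) (c : ℝ) : mean μ (fun _ => c) = c := by
  rw [mean, tsum_mul_right, ← ENNReal.tsum_toReal_eq (fun z => μ.apply_ne_top z), μ.tsum_coe]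
  simp

theorem mean_mono {α : Type} {μ : PMF α} (hμ : μ.support.Finite) {F G : α → ℝ}
    (h : ∀ z, F z ≤ G z) : mean μ F ≤ mean μ G :=
  (summable_mean hμ F).tsum_le_tsum
    (fun z => mul_le_mul_of_nonneg_left (h z) ENNReal.toReal_nonneg) (summable_mean hμ G)

theorem abs_mean_le {α : Type} {μ : PMF α} (hμ : μ.support.Finite) {F : α → ℝ} {K : ℝ}
    (h : ∀ z, |F z| ≤ K) : |mean μ F| ≤ K := by
  have h1 := mean_mono hμ fun z => (abs_le.1 (h z)).1
  have h2 := mean_mono hμ fun z => (abs_le.1 (h z)).2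
  rw [mean_const] at h1 h2
  exact abs_le.2 ⟨h1, h2⟩

theorem support_bind_finite {α β : Type} {μ : PMF α} {f : α → PMF β} (hμ : μ.support.Finite)
    (hf : ∀ a, (f a).support.Finite) : (μ.bind f).support.Finite := by
  rw [PMF.support_bind]
  exact hμ.biUnion fun a _ => hf a

theorem support_map_finite {α β : Type} {μ : PMF α} (g : α → β) (hμ : μ.support.Finite) :
    (μ.map g).support.Finite := by
  rw [PMF.support_map]
  exact hμ.image g

theorem mean_bind {α β : Type} {μ : PMF α} {f : α → PMF β} (hμ : μ.support.Finite)
    (hf : ∀ a, (f a).support.Finite) (F : β → ℝ) :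
    mean (μ.bind f) F = mean μ fun a => mean (f a) F := by
  have hzero : ∀ a ∉ hμ.toFinset, μ a = 0 := fun a ha => by
    rwa [Set.Finite.mem_toFinset, PMF.mem_support_iff, not_not] at ha
  have e : ∀ z, ((μ.bind f) z).toReal * F z =
      ∑ a ∈ hμ.toFinset, (μ a).toReal * ((f a z).toReal * F z) := by
    intro z
    rw [PMF.bind_apply, tsum_eq_sum fun a ha => by rw [hzero a ha, zero_mul],
      ENNReal.toReal_sum fun a _ => ENNReal.mul_ne_top (μ.apply_ne_top a) ((f a).apply_ne_top z),
      Finset.sum_mul]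
    exact Finset.sum_congr rfl fun a _ => by rw [ENNReal.toReal_mul, mul_assoc]
  rw [mean, tsum_congr e,
    Summable.tsum_finsetSum fun a _ => (summable_mean (hf a) F).mul_left _, mean,
    tsum_eq_sum fun a ha => by rw [hzero a ha, ENNReal.toReal_zero, zero_mul]]
  exact Finset.sum_congr rfl fun a _ => tsum_mul_left

theorem mean_pure {α : Type} (a : α) (F : α → ℝ) : mean (PMF.pure a) F = F a := by
  rw [mean, tsum_eq_single a fun b hb => by rw [PMF.pure_apply_of_ne _ _ hb]; simp]
  simp

theorem support_pure_finite {α : Type} (a : α) : (PMF.pure a).support.Finite := by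
  rw [PMF.support_pure]
  exact Set.finite_singleton a

theorem mean_map {α β : Type} {μ : PMF α} (g : α → β) (hμ : μ.support.Finite) (F : β → ℝ) :
    mean (μ.map g) F = mean μ fun a => F (g a) := by
  rw [PMF.map, mean_bind (f := PMF.pure ∘ g) hμ fun a => support_pure_finite (g a)]
  simp only [Function.comp_apply, mean_pure]

theorem support_choice_finite {α : Type} (t : I) (x y : α) : (choice t x y).support.Finite :=
  support_map_finite _ (Set.toFinite _)

theorem mean_choice {α : Type} (t : I) (x y : α) (F : α → ℝ) :
    mean (choice t x y) F = t * F x + (1 - t) * F y := by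
  rw [choice, mean_map _ (Set.toFinite _), mean, tsum_fintype, Fintype.sum_bool]
  simp only [PMF.ofFintype_apply, if_true, Bool.false_eq_true, if_false]
  rw [ENNReal.toReal_ofReal t.2.1, ENNReal.toReal_ofReal (sub_nonneg.2 t.2.2)]

/-- The expectation of `F` at the state that follows `s`. -/
noncomputable def nextMean (p : I) (s : State) (F : State → ℝ) : ℝ :=
  match s with
  | State.lo => p * F State.lo + (1 - p) * F State.hi
  | State.hi => p * F State.hi + (1 - p) * F State.lo

theorem mean_nextState (p : I) (s : State) (F : State → ℝ) :
    mean (nextState p s) F = nextMean p s F := by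
  cases s <;> exact mean_choice _ _ _ _

theorem support_nextState_finite (p : I) (s : State) : (nextState p s).support.Finite := by
  cases s <;> exact support_choice_finite _ _ _

/-- The expectation of `F` after one more stage, given the past stages and the current state. -/
noncomputable def step (p : I) (s₁ : Strategy₁) (s₂ : Strategy₂) (F : List Stage × State → ℝ)
    (z : List Stage × State) : ℝ :=
  let x : ℝ := s₁ z.1 z.2
  let y : ℝ := s₂ (z.1.map Prod.snd)
  let N a b := nextMean p z.2 fun s' => F ((z.2, a, b) :: z.1, s')
  x * (y * N Move₁.T Move₂.L + (1 - y) * N Move₁.T Move₂.R) +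
    (1 - x) * (y * N Move₁.B Move₂.L + (1 - y) * N Move₁.B Move₂.R)

theorem support_playLaw_finite (p q : I) (s₁ : Strategy₁) (s₂ : Strategy₂) (n : ℕ) :
    (playLaw p q s₁ s₂ n).support.Finite := by
  induction n with
  | zero => exact support_map_finite _ (support_choice_finite _ _ _)
  | succ n ih =>
    exact support_bind_finite ih fun z => support_bind_finite (support_choice_finite _ _ _)
      fun a => support_bind_finite (support_choice_finite _ _ _)
        fun b => support_map_finite _ (support_nextState_finite _ _)

theorem mean_playLaw_succ (p q : I) (s₁ : Strategy₁) (s₂ : Strategy₂) (n : ℕ)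
    (F : List Stage × State → ℝ) :
    mean (playLaw p q s₁ s₂ (n + 1)) F = mean (playLaw p q s₁ s₂ n) (step p s₁ s₂ F) := by
  rw [playLaw, mean_bind (support_playLaw_finite p q s₁ s₂ n) fun z =>
    support_bind_finite (support_choice_finite _ _ _) fun a =>
      support_bind_finite (support_choice_finite _ _ _)
        fun b => support_map_finite _ (support_nextState_finite _ _)]
  congr 1
  funext z
  rw [mean_bind (support_choice_finite _ _ _) fun a =>
      support_bind_finite (support_choice_finite _ _ _)
        fun b => support_map_finite _ (support_nextState_finite _ _), mean_choice]
  simp only [mean_bind (support_choice_finite _ _ _)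
    fun b => support_map_finite _ (support_nextState_finite _ _), mean_choice,
    mean_map _ (support_nextState_finite _ _), mean_nextState, step]

/-- The total gain of Player 1 in the past stages. -/
def totalGain (z : List Stage × State) : ℝ := (z.1.map payoff).sum

theorem averageGain_eq (p q : I) (s₁ : Strategy₁) (s₂ : Strategy₂) (n : ℕ) :
    averageGain p q s₁ s₂ n = mean (playLaw p q s₁ s₂ n) totalGain / n := rfl

theorem mean_totalGain_zero (p q : I) (s₁ : Strategy₁) (s₂ : Strategy₂) :
    mean (playLaw p q s₁ s₂ 0) totalGain = 0 := by
  rw [playLaw, mean_map _ (support_choice_finite _ _ _)]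
  simp only [totalGain, List.map_nil, List.sum_nil]
  exact mean_const _ 0

/-- The probability-`x` mixture of moves of Player 1 against the probability-`y` mixture of moves
of Player 2 in state `s` gives this expected gain. -/
def stageGain (x y : ℝ) : State → ℝ
  | State.lo => x * y
  | State.hi => (1 - x) * (1 - y)

theorem step_totalGain_add (p : I) (s₁ : Strategy₁) (s₂ : Strategy₂)
    (H : List Stage × State → ℝ) (z : List Stage × State) :
    step p s₁ s₂ (fun z => totalGain z + H z) z =
      totalGain z + stageGain (s₁ z.1 z.2) (s₂ (z.1.map Prod.snd)) z.2 +
        step p s₁ s₂ H z := by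
  obtain ⟨l, s⟩ := z
  cases s <;>
  · simp only [step, nextMean, totalGain, List.map_cons, List.sum_cons, payoff, stageGain]
    ring

/-- Total gain plus H, minus nv, is a supermartingale; the bounded H changes the average by at most
2K/n. -/
theorem guarantees₂_of_potential {p : I} {s₂ : Strategy₂} {v K : ℝ}
    {H : List Stage × State → ℝ} (hK : ∀ z, |H z| ≤ K)
    (hH : ∀ s₁ z, stageGain (s₁ z.1 z.2) (s₂ (z.1.map Prod.snd)) z.2 + step p s₁ s₂ H z ≤
      v + H z) : Guarantees₂ p s₂ v := by
  intro q s₁ w hw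
  have hfin := support_playLaw_finite p q s₁ s₂
  have hbound : ∀ n : ℕ, mean (playLaw p q s₁ s₂ n) (fun z => totalGain z + H z) ≤ n * v + K := by
    intro n
    induction n with
    | zero =>
      rw [mean_add (hfin 0), mean_totalGain_zero]
      have := (abs_le.1 (abs_mean_le (hfin 0) hK)).2
      simpa using this
    | succ n ih =>
      rw [mean_playLaw_succ]
      have h1 := mean_mono (hfin n) (F := step p s₁ s₂ fun z => totalGain z + H z)
        (G := fun z => (totalGain z + H z) + v) fun z => by
          rw [step_totalGain_add]
          linarith [hH s₁ z]
      rw [mean_add (hfin n), mean_const] at h1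
      push_cast
      linarith
  have hlim : Tendsto (fun n : ℕ => v + 2 * K / n) atTop (nhds v) := by
    simpa using (tendsto_const_div_atTop_nhds_zero_nat (2 * K)).const_add v
  filter_upwards [hlim.eventually_lt_const hw, eventually_gt_atTop 0] with n hn hn0
  refine lt_of_le_of_lt ?_ hn
  have hn' : (0 : ℝ) < n := Nat.cast_pos.2 hn0
  have h1 := hbound n
  rw [mean_add (hfin n)] at h1
  have h2 := (abs_le.1 (abs_mean_le (hfin n) hK)).1
  rw [averageGain_eq, div_le_iff₀ hn', add_mul, div_mul_cancel₀ _ hn'.ne']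
  linarith

theorem belief_mem_Icc {p θ₀ : I} (hp : 1 / 2 ≤ (p : ℝ)) (a : Move₁) (l : List Move₁) :
    (belief p θ₀ (a :: l) : ℝ) ∈ Set.Icc (1 - (p : ℝ)) p := by
  cases a
  · exact fT_mem_Icc hp (belief p θ₀ l).2.1
  · exact fB_mem_Icc hp (belief p θ₀ l).2.2

/-! ### Player 2 guarantees the value -/

/-- The probability with which Player 2 should play `L` if the belief is `θ`. -/
noncomputable def probL (p θ : ℝ) : ℝ :=
  if 1 / 2 < θ then tangent p p (fB p θ) - tangent p p p
  else if θ < 1 / 2 then 1 - (tangent p p (fB p (1 - θ)) - tangent p p p)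
  else 1 / 2

theorem probL_of_half_lt {p θ : ℝ} (h : 1 / 2 < θ) :
    probL p θ = tangent p p (fB p θ) - tangent p p p := if_pos h

theorem probL_half (p : ℝ) : probL p (1 / 2) = 1 / 2 := by
  rw [probL, if_neg (lt_irrefl _), if_neg (lt_irrefl _)]

theorem probL_one_sub (p θ : ℝ) : probL p (1 - θ) = 1 - probL p θ := by
  rcases lt_trichotomy θ (1 / 2) with h | h | h
  · rw [probL_of_half_lt (by linarith), probL, if_neg h.not_gt, if_pos h]
    ring
  · subst h
    norm_num [probL]
  · rw [probL_of_half_lt h, probL, if_neg (by linarith), if_pos (by linarith), sub_sub_cancel]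

/-- The potential in the state `s` at the belief `θ`. -/
noncomputable def potential (p θ : ℝ) : State → ℝ
  | State.lo => tangent p 1 θ
  | State.hi => tangent p 0 θ

theorem nextMean_potential_lo (p : I) (θ : ℝ) :
    nextMean p State.lo (potential p θ) = tangent p p θ :=
  (tangent_affine p p θ).symm

theorem nextMean_potential_hi (p : I) (θ : ℝ) :
    nextMean p State.hi (potential p θ) = tangent p (1 - p) θ := by
  rw [tangent_affine]
  simp only [nextMean, potential]
  ring

theorem probL_mem {p : ℝ} (hfin : ∑' n : ℕ, pressureSum p n < ⊤) (hp : 1 / 2 ≤ p) (hp1 : p ≤ 1)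
    {θ : ℝ} (hθ : θ ∈ Set.Icc (1 - p) p) : probL p θ ∈ I := by
  have key : ∀ τ ∈ Set.Ioc (1 / 2) p, probL p τ ∈ I := by
    intro τ hτ
    rw [probL_of_half_lt hτ.1]
    refine ⟨tangent_sub_nonneg hfin hp hp1 _, tangent_sub_le_one hfin hp hp1 ?_⟩
    rw [← fB_half p]
    exact fB_lt_fB (hτ.1.trans_le hτ.2) le_rfl hτ.1
  rcases lt_trichotomy θ (1 / 2) with h | h | h
  · have h1 := key (1 - θ) ⟨by linarith, by linarith [hθ.1]⟩
    rw [probL_one_sub] at h1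
    exact ⟨by linarith [h1.2], by linarith [h1.1]⟩
  · rw [h, probL_half]
    constructor <;> norm_num
  · exact key θ ⟨h, hθ.2⟩

/-- Against `probL`, no move of Player 1 gains more than the value, in either state. -/
theorem gain_add_tangent_le {p : ℝ} (hfin : ∑' n : ℕ, pressureSum p n < ⊤) (hp : 1 / 2 ≤ p)
    (hp1 : p ≤ 1) {θ : ℝ} (hθ : θ ∈ Set.Icc (1 - p) p) :
    (probL p θ + tangent p p (fT p θ) ≤ gameValue p + tangent p 1 θ ∧
      tangent p p (fB p θ) ≤ gameValue p + tangent p 1 θ) ∧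
    (tangent p (1 - p) (fT p θ) ≤ gameValue p + tangent p 0 θ ∧
      1 - probL p θ + tangent p (1 - p) (fB p θ) ≤ gameValue p + tangent p 0 θ) := by
  have key : ∀ τ ∈ Set.Icc (1 / 2) p,
      (probL p τ + tangent p p (fT p τ) ≤ gameValue p + tangent p 1 τ ∧
        tangent p p (fB p τ) ≤ gameValue p + tangent p 1 τ) ∧
      (tangent p (1 - p) (fT p τ) ≤ gameValue p + tangent p 0 τ ∧
        1 - probL p τ + tangent p (1 - p) (fB p τ) ≤ gameValue p + tangent p 0 τ) := by
    intro τ hτ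
    rcases hτ.1.eq_or_lt with h | h
    · have h0 : tangent p 0 (1 / 2) = tangent p 1 (1 / 2) := by
        have := tangent_one_sub hfin hp hp1 1 (1 / 2)
        norm_num at this ⊢
        exact this
      have h1 := tangent_left_le hfin hp hp1
      have h2 := tangent_one_sub hfin hp hp1 p p
      have h3 := tangent_one_sub hfin hp hp1 p (1 - p)
      rw [sub_sub_cancel] at h3
      rw [← h, probL_half, fB_half, fT_half, h0, h2, h3, gameValue]
      refine ⟨⟨?_, ?_⟩, ?_, ?_⟩ <;> linarith
    · have hτ' : τ ∈ Set.Ioc (1 / 2) p := ⟨h, hτ.2⟩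
      have h1 := gameValue_add_tangent_one hfin hp1 hτ'
      have h2 := gameValue_add_tangent_zero hfin hp1 hτ'
      have h3 := tangent_right_le hfin hp1 hτ'
      have h4 := tangent_sub_nonneg hfin hp hp1 (fB p τ)
      have h5 : fT p τ = p := if_pos h.le
      rw [probL_of_half_lt h, h5]
      refine ⟨⟨?_, ?_⟩, ?_, ?_⟩ <;> linarith
  rcases le_total (1 / 2) θ with h | h
  · exact key θ ⟨h, hθ.2⟩
  · obtain ⟨⟨h1, h2⟩, h3, h4⟩ := key (1 - θ) ⟨by linarith, by linarith [hθ.1]⟩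
    have e0 := tangent_one_sub hfin hp hp1 0 θ
    have e1 := tangent_one_sub hfin hp hp1 1 θ
    rw [sub_zero] at e0
    rw [sub_self] at e1
    have eT := tangent_one_sub hfin hp hp1 (1 - p) (fB p θ)
    have eB := tangent_one_sub hfin hp hp1 (1 - p) (fT p θ)
    rw [sub_sub_cancel] at eT eB
    rw [fT_one_sub, probL_one_sub, eT, e0] at h1
    rw [fB_one_sub, eB, e0] at h2
    rw [fT_one_sub, tangent_one_sub hfin hp hp1, e1] at h3
    rw [fB_one_sub, probL_one_sub, tangent_one_sub hfin hp hp1, e1] at h4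
    refine ⟨⟨?_, ?_⟩, ?_, ?_⟩ <;> linarith

/-- Player 2 does not know the initial law and need not: any starting belief in [1-p, p] would do.
Here it is p, so that `probL` is a probability from the first stage on. -/
theorem belief_self_mem {p : I} (hp : 1 / 2 ≤ (p : ℝ)) (l : List Move₁) :
    (belief p p l : ℝ) ∈ Set.Icc (1 - (p : ℝ)) p := by
  cases l with
  | nil => exact ⟨by change 1 - (p : ℝ) ≤ p; linarith, le_rfl⟩
  | cons a l => exact belief_mem_Icc hp a l

/-- The strategy of Player 2 that plays `probL` at the belief induced by the moves of Player 1. -/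
noncomputable def tauStar (p : I) : Strategy₂ := fun l =>
  Set.projIcc 0 1 zero_le_one (probL p (belief p p (l.map Prod.fst)))

theorem guarantees₂_tauStar {p : I} (hp : 1 / 2 ≤ (p : ℝ))
    (hfin : ∑' n : ℕ, pressureSum p n < ⊤) : Guarantees₂ p (tauStar p) (gameValue p) := by
  have hp1 : (p : ℝ) ≤ 1 := p.2.2
  obtain ⟨K, hK⟩ := exists_abs_tangent_le hfin hp hp1
  refine guarantees₂_of_potential (K := K)
    (H := fun z => potential p (belief p p (z.1.map fun w => w.2.1)) z.2) ?_ ?_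
  · rintro ⟨l, s⟩
    cases s
    · exact hK 1 (by simp) _
    · exact hK 0 (by simp) _
  · rintro s₁ ⟨l, s⟩
    set θ := belief p p (l.map fun w => w.2.1) with hθ
    have hmem := belief_self_mem hp (l.map fun w => w.2.1)
    have hy : (tauStar p (l.map Prod.snd) : ℝ) = probL p θ := by
      rw [tauStar, List.map_map, show (Prod.fst ∘ Prod.snd : Stage → Move₁) = fun w => w.2.1 from rfl,
        Set.projIcc_of_mem _ (probL_mem hfin hp hp1 hmem)]
    obtain ⟨⟨h1, h2⟩, h3, h4⟩ := gain_add_tangent_le hfin hp hp1 hmem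
    rw [← hθ] at h1 h2 h3 h4
    obtain ⟨hx0, hx1⟩ := (s₁ l s).2
    have hx1' : 0 ≤ 1 - (s₁ l s : ℝ) := by linarith
    simp only [step, hy, List.map_cons, belief, ← hθ]
    cases s
    · simp only [nextMean_potential_lo]
      simp only [stageGain, potential]
      linarith [mul_le_mul_of_nonneg_left h1 hx0, mul_le_mul_of_nonneg_left h2 hx1']
    · simp only [nextMean_potential_hi]
      simp only [stageGain, potential]
      linarith [mul_le_mul_of_nonneg_left h3 hx0, mul_le_mul_of_nonneg_left h4 hx1']

/-! ### Player 1 guarantees the value -/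

theorem tangent_self_one_sub {p : ℝ} (hfin : ∑' n : ℕ, pressureSum p n < ⊤) (hp : 1 / 2 ≤ p)
    (hp1 : p ≤ 1) (θ : ℝ) : tangent p (1 - θ) (1 - θ) = tangent p θ θ :=
  tangent_one_sub hfin hp hp1 θ θ

/-- The optimality equation of the value function. -/
theorem gameValue_add_tangent_self {p : ℝ} (hfin : ∑' n : ℕ, pressureSum p n < ⊤) (hp : 1 / 2 ≤ p)
    (hp1 : p ≤ 1) {θ : ℝ} (hθ : θ ∈ Set.Icc (1 - p) p) :
    gameValue p + tangent p θ θ =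
      min θ (1 - θ) + (1 - θ) * tangent p (fT p θ) (fT p θ) +
        θ * tangent p (fB p θ) (fB p θ) := by
  have key : ∀ τ ∈ Set.Icc (1 / 2) p, gameValue p + tangent p τ τ =
      min τ (1 - τ) + (1 - τ) * tangent p (fT p τ) (fT p τ) +
        τ * tangent p (fB p τ) (fB p τ) := by
    intro τ hτ
    rw [min_eq_right (by linarith [hτ.1])]
    rcases hτ.1.eq_or_lt with h | h
    · have h0 : tangent p 0 (1 / 2) = tangent p 1 (1 / 2) := by
        have := tangent_one_sub hfin hp hp1 1 (1 / 2)
        norm_num at this ⊢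
        exact this
      rw [← h, fB_half, fT_half, tangent_self_one_sub hfin hp hp1, tangent_affine p (1 / 2),
        h0, gameValue]
      ring
    · have hτ' : τ ∈ Set.Ioc (1 / 2) p := ⟨h, hτ.2⟩
      have h1 := gameValue_add_tangent_one hfin hp1 hτ'
      have h2 := gameValue_add_tangent_zero hfin hp1 hτ'
      have h5 : fT p τ = p := if_pos h.le
      -- The left side is the joint probability of B followed by `lo`; it is affine in τ, which lets
      -- the two tangent equations be averaged with weights τ and 1-τ.
      have h6 : τ * fB p τ = τ * (3 * p - 1) - (2 * p - 1) := by
        have : τ ≠ 0 := by linarith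
        rw [fB_of_half_le h.le]
        field_simp
      rw [h5, tangent_affine p τ τ, tangent_affine p (fB p τ)]
      rw [tangent_affine p p (fB p τ)] at h1 h2
      rw [tangent_affine p (1 - p) (fB p τ)] at h2
      linear_combination τ * h1 + (1 - τ) * h2 -
        (tangent p 1 (fB p τ) - tangent p 0 (fB p τ)) * h6
  rcases le_total (1 / 2) θ with h | h
  · exact key θ ⟨h, hθ.2⟩
  · have h1 := key (1 - θ) ⟨by linarith, by linarith [hθ.1]⟩
    rw [fT_one_sub, fB_one_sub, tangent_self_one_sub hfin hp hp1,
      tangent_self_one_sub hfin hp hp1, tangent_self_one_sub hfin hp hp1, sub_sub_cancel,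
      min_comm] at h1
    linarith

/-- The value function at an arbitrary belief. -/
noncomputable def beliefValue (p θ : ℝ) : ℝ :=
  min θ (1 - θ) + (1 - θ) * tangent p (fT p θ) (fT p θ) + θ * tangent p (fB p θ) (fB p θ) -
    gameValue p

/-- θ₀ may lie outside [1-p, p], but one move brings it inside, so the right side of the optimality
equation serves as the definition of V there. -/
theorem gameValue_add_beliefValue {p θ : ℝ} (hfin : ∑' n : ℕ, pressureSum p n < ⊤)
    (hp : 1 / 2 ≤ p) (hp1 : p ≤ 1) (h0 : 0 ≤ θ) (h1 : θ ≤ 1) :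
    gameValue p + beliefValue p θ =
      min θ (1 - θ) + (1 - θ) * beliefValue p (fT p θ) + θ * beliefValue p (fB p θ) := by
  have h : ∀ τ ∈ Set.Icc (1 - p) p, beliefValue p τ = tangent p τ τ := fun τ hτ => by
    rw [beliefValue, ← gameValue_add_tangent_self hfin hp hp1 hτ]
    ring
  rw [h _ (fT_mem_Icc hp h0), h _ (fB_mem_Icc hp h1), beliefValue]
  ring

theorem abs_combination_le {x a b K : ℝ} (hx : x ∈ Set.Icc (0 : ℝ) 1) (ha : |a| ≤ K)
    (hb : |b| ≤ K) : |x * a + (1 - x) * b| ≤ K := by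
  obtain ⟨h0, h1⟩ := hx
  obtain ⟨ha1, ha2⟩ := abs_le.1 ha
  obtain ⟨hb1, hb2⟩ := abs_le.1 hb
  exact abs_le.2 ⟨by nlinarith, by nlinarith⟩

theorem exists_abs_beliefValue_le {p : ℝ} (hfin : ∑' n : ℕ, pressureSum p n < ⊤)
    (hp : 1 / 2 ≤ p) (hp1 : p ≤ 1) :
    ∃ K, ∀ θ ∈ Set.Icc (0 : ℝ) 1, |beliefValue p θ| ≤ K := by
  obtain ⟨K, hK⟩ := exists_abs_tangent_le hfin hp hp1
  refine ⟨1 + K + |gameValue p|, fun θ hθ => ?_⟩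
  have hT := fT_mem_Icc hp hθ.1
  have hB := fB_mem_Icc hp hθ.2
  have h1 := abs_combination_le hθ
    (hK (fB p θ) ⟨by linarith [hB.1], by linarith [hB.2]⟩ (fB p θ))
    (hK (fT p θ) ⟨by linarith [hT.1], by linarith [hT.2]⟩ (fT p θ))
  have h2 : |min θ (1 - θ)| ≤ 1 := abs_le.2
    ⟨le_min (by linarith [hθ.1]) (by linarith [hθ.2]), (min_le_left _ _).trans hθ.2⟩
  rw [beliefValue]
  rw [abs_le] at h1 h2 ⊢
  have h3 := neg_abs_le (gameValue p)
  have h4 := le_abs_self (gameValue p)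
  constructor <;> linarith [h1.1, h1.2, h2.1, h2.2]

/-- With `mul_one_sub_probT_hi`: at belief θ, L and R give Player 1 the same expected gain. -/
theorem mul_probT_lo (θ : ℝ) : θ * probT θ State.lo = min θ (1 - θ) := by
  rw [probT]
  split_ifs with h
  · rw [mul_one, min_eq_left (by linarith)]
  · rw [min_eq_right (by linarith), mul_div_cancel₀ _ (by linarith)]

theorem mul_one_sub_probT_hi (θ : ℝ) : (1 - θ) * (1 - probT θ State.hi) = min θ (1 - θ) := by
  rw [probT]
  split_ifs with h
  · have : 1 - θ ≠ 0 := by linarith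
    rw [min_eq_left (by linarith)]
    field_simp
    ring
  · rw [min_eq_right (by linarith)]
    ring

/-- The deviation of the indicator of `lo` from its conditional probability `θ`. -/
def deviation (θ : ℝ) : State → ℝ
  | State.lo => 1 - θ
  | State.hi => -θ

theorem abs_deviation_le {θ : ℝ} (hθ : θ ∈ Set.Icc (0 : ℝ) 1) (s : State) :
    |deviation θ s| ≤ 1 := by
  obtain ⟨h0, h1⟩ := hθ
  cases s <;> rw [deviation, abs_le] <;> constructor <;> linarith

/-- Playing `σ*` with the internal state `θ` contracts the deviation by `γ`. -/
theorem exists_deviation_factor (p θ : I) (hp : 1 / 2 ≤ (p : ℝ)) : ∃ c : Move₁ → ℝ,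
    |c Move₁.T| + |c Move₁.B| ≤ 2 * p - 1 ∧ ∀ s,
      probT θ s * nextMean p s (deviation (fT p θ)) = deviation θ s * c Move₁.T ∧
      (1 - probT θ s) * nextMean p s (deviation (fB p θ)) = deviation θ s * c Move₁.B := by
  obtain ⟨θ, h0, h1⟩ := θ
  dsimp only
  by_cases h : θ ≤ 1 / 2
  · have hθ : 0 < 1 - θ := by linarith
    have hle : (1 - 2 * θ) / (1 - θ) ^ 2 ≤ 1 := by
      rw [div_le_one (by positivity)]
      nlinarith
    have hnn : 0 ≤ (1 - 2 * θ) / (1 - θ) ^ 2 := div_nonneg (by linarith) (by positivity)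
    -- For θ ≤ 1/2, B is played only in state `hi`, so it reveals the state: the next deviation has
    -- mean 0 and the factor for B vanishes.
    refine ⟨fun a => match a with
      | Move₁.T => (2 * p - 1) * ((1 - 2 * θ) / (1 - θ) ^ 2)
      | Move₁.B => 0, ?_, ?_⟩
    · rw [abs_zero, add_zero, abs_of_nonneg (mul_nonneg (by linarith) hnn)]
      exact mul_le_of_le_one_right (by linarith) hle
    · have hT : fT p θ = p * (θ / (1 - θ)) + (1 - p) * ((1 - 2 * θ) / (1 - θ)) := by
        rcases h.eq_or_lt with h | h
        · rw [h, fT_half]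
          norm_num
        · exact if_neg h.not_ge
      have hB : fB p θ = 1 - p := by
        rcases h.eq_or_lt with h | h
        · rw [h, fB_half]
        · exact if_neg h.not_ge
      intro s
      rw [hT, hB]
      cases s <;> simp only [probT, if_pos h, nextMean, deviation] <;> constructor <;>
        field_simp <;> ring
  · have hθ : 0 < θ := by linarith
    have hle : (2 * θ - 1) / θ ^ 2 ≤ 1 := by
      rw [div_le_one (by positivity)]
      nlinarith
    have hnn : 0 ≤ (2 * θ - 1) / θ ^ 2 := div_nonneg (by linarith) (by positivity)
    refine ⟨fun a => match a with
      | Move₁.T => 0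
      | Move₁.B => (2 * p - 1) * ((2 * θ - 1) / θ ^ 2), ?_, ?_⟩
    · rw [abs_zero, zero_add, abs_of_nonneg (mul_nonneg (by linarith) hnn)]
      exact mul_le_of_le_one_right (by linarith) hle
    · have hT : fT p θ = p := if_pos (by linarith)
      have hB := fB_of_half_le (p := p) (θ := θ) (by linarith)
      intro s
      rw [hT, hB]
      cases s <;> simp only [probT, if_neg h, nextMean, deviation] <;> constructor <;>
        field_simp <;> ring

/-- The internal state of `σ*` after the given moves. -/
noncomputable def beliefAt (p θ₀ : I) (l : List (Move₁ × Move₂)) : I :=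
  belief p θ₀ (l.map Prod.fst)

theorem sigmaStar_apply (p θ₀ : I) (l : List Stage) (s : State) :
    (sigmaStar p θ₀ l s : ℝ) = probT (beliefAt p θ₀ (l.map Prod.snd)) s := by
  rw [sigmaStar, beliefAt, List.map_map]
  rfl

theorem beliefAt_T (p θ₀ : I) (b : Move₂) (l : List (Move₁ × Move₂)) :
    (beliefAt p θ₀ ((Move₁.T, b) :: l) : ℝ) = fT p (beliefAt p θ₀ l) := rfl

theorem beliefAt_B (p θ₀ : I) (b : Move₂) (l : List (Move₁ × Move₂)) :
    (beliefAt p θ₀ ((Move₁.B, b) :: l) : ℝ) = fB p (beliefAt p θ₀ l) := rfl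

theorem nextMean_mul_const (p : I) (s : State) (F : State → ℝ) (c : ℝ) :
    nextMean p s (fun s' => F s' * c) = nextMean p s F * c := by
  cases s <;> simp only [nextMean] <;> ring

theorem nextMean_const (p : I) (s : State) (c : ℝ) : nextMean p s (fun _ => c) = c := by
  cases s <;> simp only [nextMean] <;> ring

/-- Under `σ*`, the conditional law of the state given the past moves merges with the internal
state of Player 1 exponentially fast, whatever the initial law. -/
theorem abs_mean_deviation_le {p θ₀ : I} (hp : 1 / 2 ≤ (p : ℝ)) (q : I) (s₂ : Strategy₂) (n : ℕ)
    {K : ℝ} (ψ : List (Move₁ × Move₂) → ℝ) (hψ : ∀ l, |ψ l| ≤ K) :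
    |mean (playLaw p q (sigmaStar p θ₀) s₂ n) fun z =>
        deviation (beliefAt p θ₀ (z.1.map Prod.snd)) z.2 * ψ (z.1.map Prod.snd)| ≤
      (2 * p - 1) ^ n * K := by
  induction n generalizing K ψ with
  | zero =>
    refine abs_mean_le (support_playLaw_finite _ _ _ _ _) fun z => ?_
    rw [pow_zero, one_mul, abs_mul]
    exact (mul_le_of_le_one_left (abs_nonneg _) (abs_deviation_le (beliefAt p θ₀ _).2 _)).trans
      (hψ _)
  | succ n ih =>
    choose c hc hstep using fun l => exists_deviation_factor p (beliefAt p θ₀ l) hp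
    have hK : 0 ≤ K := (abs_nonneg _).trans (hψ [])
    -- Averaging over the last stage gives the deviation one stage earlier times ψ', whose bound is
    -- smaller by γ. The induction therefore has to range over all test functions.
    set ψ' : List (Move₁ × Move₂) → ℝ := fun l =>
      c l Move₁.T * (s₂ l * ψ ((Move₁.T, Move₂.L) :: l) +
        (1 - s₂ l) * ψ ((Move₁.T, Move₂.R) :: l)) +
      c l Move₁.B * (s₂ l * ψ ((Move₁.B, Move₂.L) :: l) +
        (1 - s₂ l) * ψ ((Move₁.B, Move₂.R) :: l)) with hψ'
    have hbound : ∀ l, |ψ' l| ≤ (2 * p - 1) * K := by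
      intro l
      have h1 := abs_combination_le (s₂ l).2 (hψ ((Move₁.T, Move₂.L) :: l))
        (hψ ((Move₁.T, Move₂.R) :: l))
      have h2 := abs_combination_le (s₂ l).2 (hψ ((Move₁.B, Move₂.L) :: l))
        (hψ ((Move₁.B, Move₂.R) :: l))
      calc |ψ' l| ≤ |c l Move₁.T| * K + |c l Move₁.B| * K := by
            refine (abs_add_le _ _).trans (add_le_add ?_ ?_) <;> rw [abs_mul]
            · exact mul_le_mul_of_nonneg_left h1 (abs_nonneg _)
            · exact mul_le_mul_of_nonneg_left h2 (abs_nonneg _)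
        _ = (|c l Move₁.T| + |c l Move₁.B|) * K := by ring
        _ ≤ (2 * p - 1) * K := mul_le_mul_of_nonneg_right (hc l) hK
    have e : step p (sigmaStar p θ₀) s₂ (fun z =>
        deviation (beliefAt p θ₀ (z.1.map Prod.snd)) z.2 * ψ (z.1.map Prod.snd)) =
        fun z => deviation (beliefAt p θ₀ (z.1.map Prod.snd)) z.2 * ψ' (z.1.map Prod.snd) := by
      funext z
      obtain ⟨h1, h2⟩ := hstep (z.1.map Prod.snd) z.2
      simp only [step, sigmaStar_apply, List.map_cons, beliefAt_T, beliefAt_B,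
        nextMean_mul_const, hψ']
      linear_combination
        (s₂ (z.1.map Prod.snd) * ψ ((Move₁.T, Move₂.L) :: z.1.map Prod.snd) +
          (1 - s₂ (z.1.map Prod.snd)) * ψ ((Move₁.T, Move₂.R) :: z.1.map Prod.snd)) * h1 +
        (s₂ (z.1.map Prod.snd) * ψ ((Move₁.B, Move₂.L) :: z.1.map Prod.snd) +
          (1 - s₂ (z.1.map Prod.snd)) * ψ ((Move₁.B, Move₂.R) :: z.1.map Prod.snd)) * h2
    rw [mean_playLaw_succ, e, pow_succ, mul_assoc]
    exact ih ψ' hbound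

theorem guarantees₁_sigmaStar {p : I} (hp : 1 / 2 ≤ (p : ℝ))
    (hfin : ∑' n : ℕ, pressureSum p n < ⊤) (θ₀ : I) :
    Guarantees₁ p (sigmaStar p θ₀) (gameValue p) := by
  have hp1 : (p : ℝ) < 1 := lt_one_of_pressureSum p.2.2 hfin
  obtain ⟨K, hK⟩ := exists_abs_beliefValue_le hfin hp hp1.le
  intro q s₂ w hw
  have hsupp := support_playLaw_finite p q (sigmaStar p θ₀) s₂
  set γ : ℝ := 2 * p - 1 with hγ
  have hγ0 : 0 ≤ γ := by linarith
  have hγ1 : γ < 1 := by linarith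
  set H : List Stage × State → ℝ := fun z => beliefValue p (beliefAt p θ₀ (z.1.map Prod.snd))
    with hH
  have hHK : ∀ z, |H z| ≤ K := fun z => hK _ (beliefAt p θ₀ _).2
  have hK0 : 0 ≤ K := (abs_nonneg _).trans (hK 0 (by simp))
  set gain : List (Move₁ × Move₂) → State → ℝ := fun l s =>
    stageGain (probT (beliefAt p θ₀ l) s) (s₂ l) s +
      (probT (beliefAt p θ₀ l) s * beliefValue p (fT p (beliefAt p θ₀ l)) +
        (1 - probT (beliefAt p θ₀ l) s) * beliefValue p (fB p (beliefAt p θ₀ l))) with hgain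
  have hgainK : ∀ l s, |gain l s| ≤ 1 + K := by
    intro l s
    have hx := probT_mem (beliefAt p θ₀ l) s
    have h1 := abs_combination_le hx (hK _ (fT_mem p (beliefAt p θ₀ l)))
      (hK _ (fB_mem p (beliefAt p θ₀ l)))
    have h2 : |stageGain (probT (beliefAt p θ₀ l) s) (s₂ l) s| ≤ 1 := by
      obtain ⟨hx0, hx1⟩ := hx
      obtain ⟨hy0, hy1⟩ := (s₂ l).2
      cases s <;> rw [stageGain, abs_le] <;> constructor <;> nlinarith
    exact (abs_add_le _ _).trans (add_le_add h2 h1)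
  -- If the state had law θ, the optimality equation would hold exactly, with Player 2's move
  -- cancelling. `hstep` corrects this by a multiple of the deviation.
  have hfair : ∀ l : List (Move₁ × Move₂),
      beliefAt p θ₀ l * gain l State.lo + (1 - beliefAt p θ₀ l) * gain l State.hi =
        gameValue p + beliefValue p (beliefAt p θ₀ l) := by
    intro l
    have h1 := mul_probT_lo (beliefAt p θ₀ l)
    have h2 := mul_one_sub_probT_hi (beliefAt p θ₀ l)
    rw [gameValue_add_beliefValue hfin hp hp1.le (beliefAt p θ₀ l).2.1 (beliefAt p θ₀ l).2.2]
    simp only [hgain, stageGain]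
    linear_combination (s₂ l + beliefValue p (fT p (beliefAt p θ₀ l)) -
        beliefValue p (fB p (beliefAt p θ₀ l))) * h1 +
      (1 - s₂ l - beliefValue p (fT p (beliefAt p θ₀ l)) +
        beliefValue p (fB p (beliefAt p θ₀ l))) * h2
  have hstep : ∀ z, step p (sigmaStar p θ₀) s₂ (fun z => totalGain z + H z) z =
      (totalGain z + H z) + (gameValue p + deviation (beliefAt p θ₀ (z.1.map Prod.snd)) z.2 *
        (gain (z.1.map Prod.snd) State.lo - gain (z.1.map Prod.snd) State.hi)) := by
    rintro ⟨l, s⟩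
    have e : step p (sigmaStar p θ₀) s₂ (fun z => totalGain z + H z) (l, s) =
        totalGain (l, s) + gain (l.map Prod.snd) s := by
      rw [step_totalGain_add]
      simp only [step, hH, sigmaStar_apply, List.map_cons, beliefAt_T, beliefAt_B,
        nextMean_const, hgain]
      ring
    have h := hfair (l.map Prod.snd)
    rw [e]
    cases s <;> simp only [deviation, hH] <;> linear_combination h
  have hdev : ∀ n, -(γ ^ n * (2 * (1 + K))) ≤
      mean (playLaw p q (sigmaStar p θ₀) s₂ n) fun z =>
        deviation (beliefAt p θ₀ (z.1.map Prod.snd)) z.2 *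
          (gain (z.1.map Prod.snd) State.lo - gain (z.1.map Prod.snd) State.hi) := fun n =>
    (abs_le.1 (abs_mean_deviation_le hp q s₂ n (fun l => gain l State.lo - gain l State.hi)
      fun l => (abs_sub _ _).trans (by linarith [hgainK l State.lo, hgainK l State.hi]))).1
  have hbound : ∀ n : ℕ, n * gameValue p - K - 2 * (1 + K) * ∑ i ∈ Finset.range n, γ ^ i ≤
      mean (playLaw p q (sigmaStar p θ₀) s₂ n) fun z => totalGain z + H z := by
    intro n
    induction n with
    | zero =>
      rw [mean_add (hsupp 0), mean_totalGain_zero]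
      have := (abs_le.1 (abs_mean_le (hsupp 0) hHK)).1
      simpa using this
    | succ n ih =>
      rw [mean_playLaw_succ, funext hstep, mean_add (hsupp n), mean_add (hsupp n) fun _ => gameValue p,
        mean_const, Finset.sum_range_succ]
      push_cast
      linarith [hdev n]
  have hgeom : ∀ n : ℕ, ∑ i ∈ Finset.range n, γ ^ i ≤ (1 - γ)⁻¹ := fun n => by
    rw [← tsum_geometric_of_lt_one hγ0 hγ1]
    exact (summable_geometric_of_lt_one hγ0 hγ1).sum_le_tsum _ fun i _ => pow_nonneg hγ0 i
  -- The initial and final values of H cost K each; the rest is the geometric series of the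
  -- deviation errors.
  set C : ℝ := 2 * K + 2 * (1 + K) * (1 - γ)⁻¹ with hC
  have hlim : Tendsto (fun n : ℕ => gameValue p - C / n) atTop (nhds (gameValue p)) := by
    simpa using (tendsto_const_div_atTop_nhds_zero_nat C).const_sub (gameValue p)
  filter_upwards [hlim.eventually_const_lt hw, eventually_gt_atTop 0] with n hn hn0
  refine lt_of_lt_of_le hn ?_
  have hn' : (0 : ℝ) < n := Nat.cast_pos.2 hn0
  have h1 := hbound n
  rw [mean_add (hsupp n)] at h1
  have h2 := (abs_le.1 (abs_mean_le (hsupp n) hHK)).2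
  have h3 := mul_le_mul_of_nonneg_left (hgeom n) (by linarith : 0 ≤ 2 * (1 + K))
  rw [averageGain_eq, le_div_iff₀ hn', sub_mul, div_mul_cancel₀ _ hn'.ne']
  linarith

end AsymmetricGame

open AsymmetricGame unitInterval in
theorem mainTheorem2 (p : I) (hp : 1 / 2 ≤ (p : ℝ))
    (hpress : ∑' n : ℕ, pressureSum p n < ⊤) (θ₀ : I) :
    IsOptimal₁ p (sigmaStar p θ₀) :=
  ⟨gameValue p,
    ⟨⟨_, guarantees₁_sigmaStar hp hpress θ₀⟩, ⟨_, guarantees₂_tauStar hp hpress⟩⟩,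
    guarantees₁_sigmaStar hp hpress θ₀⟩
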